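/- Algorithms are programs for a randomized real RAM: exact real arithmetic ($+,-,\cdot,/$, square root, natural logarithm, comparison, conversion of integers to reals, no rounding), integer arithmetic on words of $O(\log n)$ bits, arrays with indirect addressing that are initially zero outside the input, and independent coins whose bias is a computed real number; every operation, memory access and coin takes unit time. A matrix is given by its dimensions and by the lists of the nonzero entries of its columns (compressed sparse column format); vectors are given as arrays. For real $C$ and a matrix $A\in\mathbb R^{m\times n}$ let \[\Gamma_{A,C}:=\{x\in\mathbb R^n:\ \|x\|_\infty\le 1,\ \|Ax\|_\infty\le C\sqrt{n\log(m/n+2)}\}.\] **Proposition.** There are a randomized algorithm and absolute constants $K,b$ such that the following holds for all $n\ge 100$ and all real $C\le\sqrt{\log n}/3$. The input consists of $C$ and of - a matrix $A\in\mathbb R^{m\times n}$ with $m\le n^2$, $\|A\|_{1\to\infty}=\max_{i,j}|a_{ij}|\le 1$ and at most $k$ nonzero entries in each column, - $\rho_0\in\mathbb R_{\ge 0}$ and $\rho_+,\rho_-\in(\mathbb R_{\ge 0})^m$ with $\rho_0+\|\rho_+\|_1+\|\rho_-\|_1=1$, - a vector $v\in\mathbb R^n$ with $\|v\|_2\le 2\sqrt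 n$, and a number $\Lambda\in[0,2\sqrt n]$. The algorithm always stops within $K(kn+n^2)(\log n)^b$ steps (that is, in time $\tilde O(kn+n^2)$), and with probability at least $1-1/\sqrt n$ its output is correct, namely it either - declares that the program $\sup_{x\in\Gamma_{A,C}}\langle x,v\rangle\ge\Lambda\sqrt n$ is infeasible, and this program is indeed infeasible (where $\sup\emptyset=-\infty$), or - outputs a point $x\in[-1,1]^n$ with $\|Ax\|_\infty\le 10\sqrt n(\log n)^4$ and \[-\rho_0\frac{v^Tx}{\sqrt n}+\rho_+^TAx-\rho_-^TAx\ \le\ -\rho_0\Lambda+C\sqrt{n\log(m/n+2)}\,\bigl(\|\rho_+\|_1+\|\rho_-\|_1\bigr)+\frac{\sqrt n}{(\log n)^3}.\] -/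

import Mathlib

/-! ### Randomized real RAM programs

The machine is the usual randomized real RAM: exact real arithmetic at unit cost, integers that are
machine words, indirect addressing, and coins of prescribed bias. Programs are finite pieces of
syntax in a structured language whose only loops are `for` loops, so that every run is finite. -/

namespace RealRAM

/-- The memory: arrays of machine words and arrays of real numbers, each family indexed by the name
of the array. Scalars are kept in arrays. -/
structure Mem where
  int : ℕ → ℕ → ℕ
  real : ℕ → ℕ → ℝ

/-- Write the word `x` to cell `i` of the integer array `a`. -/
def Mem.setInt (s : Mem) (a i x : ℕ) : Mem :=
  { s with int := Function.update s.int a (Function.update (s.int a) i x) }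

/-- Write the real number `x` to cell `i` of the real array `a`. -/
def Mem.setReal (s : Mem) (a i : ℕ) (x : ℝ) : Mem :=
  { s with real := Function.update s.real a (Function.update (s.real a) i x) }

/-- Integer expressions. The name of an array is a constant of the program, the index into it is
computed. -/
inductive IExp where
  | lit (c : ℕ)
  | get (a : ℕ) (i : IExp)
  | add (e f : IExp)
  | sub (e f : IExp)
  | mul (e f : IExp)
  | div (e f : IExp)
  | mod (e f : IExp)

/-- Real expressions. There is no conversion from reals to integers (no rounding). -/
inductive RExp where
  | lit (c : ℕ)
  | ofInt (e : IExp)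
  | get (a : ℕ) (i : IExp)
  | add (e f : RExp)
  | sub (e f : RExp)
  | mul (e f : RExp)
  | div (e f : RExp)
  | sqrt (e : RExp)
  | log (e : RExp)

/-- Tests. -/
inductive BExp where
  | ile (e f : IExp)
  | rle (e f : RExp)
  | not (b : BExp)
  | and (b c : BExp)

/-- Programs. -/
inductive Cmd where
  | skip
  /-- `int a [i] := e` -/
  | setInt (a : ℕ) (i e : IExp)
  /-- `real a [i] := e` -/
  | setReal (a : ℕ) (i : IExp) (e : RExp)
  /-- `int a [i] := 1` with probability `p` (clipped to `[0, 1]`), and `int a [i] := 0` otherwise;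
  the coin is independent of everything before it -/
  | flip (a : ℕ) (i : IExp) (p : RExp)
  | seq (c d : Cmd)
  | ite (b : BExp) (c d : Cmd)
  /-- evaluate `e` once, to `N` say, then for `j = 0, …, N - 1` put `int a [0] := j` and run `c` -/
  | loop (a : ℕ) (e : IExp) (c : Cmd)

/-- The value of an integer expression on a machine whose words are the integers below `W`:
arithmetic is modulo `W`, subtraction is truncated at `0`, and `e / 0 = 0`. -/
def IExp.eval (W : ℕ) (s : Mem) : IExp → ℕ
  | lit c => c % W
  | get a i => s.int a (i.eval W s)
  | add e f => (e.eval W s + f.eval W s) % W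
  | sub e f => (e.eval W s - f.eval W s) % W
  | mul e f => (e.eval W s * f.eval W s) % W
  | div e f => (e.eval W s / f.eval W s) % W
  | mod e f => (e.eval W s % f.eval W s) % W

/-- The value of a real expression. Arithmetic is exact. A division by zero, the square root of a
negative number and the logarithm of a number `≤ 0` return harmless conventional values (`0`, `0` and
`log |x|`, `log 0 = 0`) instead of stopping the machine. -/
noncomputable def RExp.eval (W : ℕ) (s : Mem) : RExp → ℝ
  | lit c => (c : ℝ)
  | ofInt e => (e.eval W s : ℝ)
  | get a i => s.real a (i.eval W s)
  | add e f => e.eval W s + f.eval W s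
  | sub e f => e.eval W s - f.eval W s
  | mul e f => e.eval W s * f.eval W s
  | div e f => e.eval W s / f.eval W s
  | sqrt e => Real.sqrt (e.eval W s)
  | log e => Real.log (e.eval W s)

/-- The truth value of a test. -/
def BExp.eval (W : ℕ) (s : Mem) : BExp → Prop
  | ile e f => e.eval W s ≤ f.eval W s
  | rle e f => e.eval W s ≤ f.eval W s
  | not b => ¬ b.eval W s
  | and b c => b.eval W s ∧ c.eval W s

/-- The number of operations and memory accesses needed to evaluate an expression. -/
def IExp.cost : IExp → ℕ
  | lit _ => 1
  | get _ i => i.cost + 1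
  | add e f => e.cost + f.cost + 1
  | sub e f => e.cost + f.cost + 1
  | mul e f => e.cost + f.cost + 1
  | div e f => e.cost + f.cost + 1
  | mod e f => e.cost + f.cost + 1

/-- The number of operations and memory accesses needed to evaluate an expression. -/
def RExp.cost : RExp → ℕ
  | lit _ => 1
  | ofInt e => e.cost + 1
  | get _ i => i.cost + 1
  | add e f => e.cost + f.cost + 1
  | sub e f => e.cost + f.cost + 1
  | mul e f => e.cost + f.cost + 1
  | div e f => e.cost + f.cost + 1
  | sqrt e => e.cost + 1
  | log e => e.cost + 1

/-- The number of operations and memory accesses needed to evaluate an expression. -/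
def BExp.cost : BExp → ℕ
  | ile e f => e.cost + f.cost + 1
  | rle e f => e.cost + f.cost + 1
  | not b => b.cost + 1
  | and b c => b.cost + c.cost + 1

/-- `body 0`, …, `body (N - 1)` one after the other, with the total number of steps, where each
iteration and the exit from the loop take one step on top of the steps of the body. -/
noncomputable def iterate (body : ℕ → Mem → PMF (Mem × ℕ)) : ℕ → Mem → PMF (Mem × ℕ)
  | 0, s => PMF.pure (s, 1)
  | N + 1, s => (iterate body N s).bind fun o => (body N o.1).bind fun o' =>
      PMF.pure (o'.1, o.2 + o'.2 + 1)

open scoped Classical in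
/-- The joint law of the final memory and of the number of steps of the run of a program from the
memory `s`, on a machine whose words are the integers below `W`. -/
noncomputable def Cmd.run (W : ℕ) : Cmd → Mem → PMF (Mem × ℕ)
  | skip, s => PMF.pure (s, 1)
  | setInt a i e, s =>
      PMF.pure (s.setInt a (i.eval W s) (e.eval W s), i.cost + e.cost + 1)
  | setReal a i e, s =>
      PMF.pure (s.setReal a (i.eval W s) (e.eval W s), i.cost + e.cost + 1)
  | flip a i p, s =>
      (PMF.bernoulli (min (p.eval W s).toNNReal 1) (min_le_right _ _)).bind fun b =>
        PMF.pure (s.setInt a (i.eval W s) (if b = true then 1 else 0), i.cost + p.cost + 1)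
  | seq c d, s => (c.run W s).bind fun o => (d.run W o.1).bind fun o' =>
      PMF.pure (o'.1, o.2 + o'.2)
  | ite b c d, s => (if b.eval W s then c.run W s else d.run W s).bind fun o =>
      PMF.pure (o.1, o.2 + b.cost + 1)
  | loop a e c, s =>
      (iterate (fun j s' => c.run W (s'.setInt a 0 j)) (e.eval W s) s).bind fun o =>
        PMF.pure (o.1, o.2 + e.cost)

/-- The number of words of a machine with `w * ⌈log₂ n⌉` bits in a word. -/
def words (w n : ℕ) : ℕ := 2 ^ (w * Nat.clog 2 n)

/-- A layout of the real matrix `A` in compressed sparse column format. The positions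
`ptr j, …, ptr (j + 1) - 1` belong to column `j`; there `row` lists the row indices of the nonzero
entries of that column, each of them once and in any order, and `val` lists these entries. -/
structure Columns {m n : ℕ} (A : Matrix (Fin m) (Fin n) ℝ) where
  ptr : ℕ → ℕ
  row : ℕ → ℕ
  val : ℕ → ℝ
  ptr_zero : ptr 0 = 0
  ptr_le : ∀ j : Fin n, ptr j ≤ ptr ((j : ℕ) + 1)
  row_bijOn : ∀ j : Fin n, Set.BijOn row (Set.Ico (ptr j) (ptr ((j : ℕ) + 1)))
    {r | ∃ i : Fin m, (i : ℕ) = r ∧ A i j ≠ 0}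
  val_eq : ∀ (j : Fin n) (i : Fin m), ∀ p ∈ Set.Ico (ptr j) (ptr ((j : ℕ) + 1)),
    row p = i → val p = A i j

/-- The vector `x` as an array, followed by zeros. -/
def ofVec {d : ℕ} (x : Fin d → ℝ) (i : ℕ) : ℝ := if h : i < d then x ⟨i, h⟩ else 0

/-- The first `d` cells of an array as a vector. -/
def toVec (d : ℕ) (f : ℕ → ℝ) : Fin d → ℝ := fun i => f i

end RealRAM

/-! ### The linear program and the oracle problem -/

namespace Oracle

open scoped Matrix

/-- The bound `C √(n log (m / n + 2))`. -/
noncomputable def discBound (C : ℝ) (m n : ℕ) : ℝ :=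
  C * √(n * Real.log (m / n + 2))

/-- The polytope `Γ_{A,C}`. The norms are maximum norms. -/
def Gam {m n : ℕ} (A : Matrix (Fin m) (Fin n) ℝ) (C : ℝ) : Set (Fin n → ℝ) :=
  {x | ‖x‖ ≤ 1 ∧ ‖A *ᵥ x‖ ≤ discBound C m n}

/-- `sup_{x ∈ Γ_{A,C}} ⟨x, v⟩ ≥ Λ √n`. The supremum is an extended real number, `-∞` if `Γ_{A,C}` is
empty. -/
def Feasible {m n : ℕ} (A : Matrix (Fin m) (Fin n) ℝ) (C : ℝ) (v : Fin n → ℝ) (Λ : ℝ) : Prop :=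
  ((Λ * √n : ℝ) : EReal) ≤ ⨆ x ∈ Gam A C, ((x ⬝ᵥ v : ℝ) : EReal)

/-- An input of the oracle, apart from the constant `C`. -/
structure Input (m n : ℕ) where
  A : Matrix (Fin m) (Fin n) ℝ
  ρ₀ : ℝ
  ρp : Fin m → ℝ
  ρm : Fin m → ℝ
  v : Fin n → ℝ
  Λ : ℝ

/-- The conditions on an input: `‖A‖_{1→∞} = max |a_{ij}| ≤ 1`, every column of `A` has at most `k`
nonzero entries, `(ρ₀, ρp, ρm)` is a probability vector, `‖v‖₂ ≤ 2 √n` and `0 ≤ Λ ≤ 2 √n`. -/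
structure Input.Valid {m n : ℕ} (I : Input m n) (k : ℕ) : Prop where
  abs_le : ∀ i j, |I.A i j| ≤ 1
  sparse : ∀ j, {i | I.A i j ≠ 0}.ncard ≤ k
  ρ₀_nonneg : 0 ≤ I.ρ₀
  ρp_nonneg : ∀ i, 0 ≤ I.ρp i
  ρm_nonneg : ∀ i, 0 ≤ I.ρm i
  sum_eq : I.ρ₀ + ∑ i, |I.ρp i| + ∑ i, |I.ρm i| = 1
  norm_v : ‖WithLp.toLp 2 I.v‖ ≤ 2 * √n
  Λ_mem : I.Λ ∈ Set.Icc 0 (2 * √n)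

/-- The point `x` has low width and satisfies the weighted constraint approximately. -/
def Input.IsGood {m n : ℕ} (I : Input m n) (C : ℝ) (x : Fin n → ℝ) : Prop :=
  (∀ j, x j ∈ Set.Icc (-1) 1) ∧
  ‖I.A *ᵥ x‖ ≤ 10 * √n * Real.log n ^ 4 ∧
  -I.ρ₀ * (I.v ⬝ᵥ x) / √n + I.ρp ⬝ᵥ (I.A *ᵥ x) - I.ρm ⬝ᵥ (I.A *ᵥ x) ≤
    -I.ρ₀ * I.Λ + discBound C m n * (∑ i, |I.ρp i| + ∑ i, |I.ρm i|) + √n / Real.log n ^ 3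

/-- The initial memory: the input in the arrays shown, with `A` in compressed sparse column format,
and zeros elsewhere. -/
def Input.mem {m n : ℕ} (I : Input m n) (C : ℝ) (L : RealRAM.Columns I.A) : RealRAM.Mem where
  int
    | 0 => fun i => if i = 0 then n else if i = 1 then m else 0
    | 1 => L.ptr
    | 2 => L.row
    | _ => 0
  real
    | 0 => fun i => if i = 0 then C else if i = 1 then I.ρ₀ else if i = 2 then I.Λ else 0
    | 1 => L.val
    | 2 => RealRAM.ofVec I.ρp
    | 3 => RealRAM.ofVec I.ρm
    | 4 => RealRAM.ofVec I.v
    | _ => 0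

/-- The output that is read off the final memory is correct: cell 0 of integer array 3 is `0`, which
means 'infeasible', and the program is indeed infeasible; or it is `1`, and real array 5 holds a
point as required. -/
def Input.Correct {m n : ℕ} (I : Input m n) (C : ℝ) (s : RealRAM.Mem) : Prop :=
  (s.int 3 0 = 0 ∧ ¬ Feasible I.A C I.v I.Λ) ∨
  (s.int 3 0 = 1 ∧ I.IsGood C (RealRAM.toVec n (s.real 5)))

end Oracle

open scoped Matrix ENNReal

namespace RealRAM

/-! ### Means and guarantees for runs -/

/-! Write the left side of the weighted constraint as ⟨w, x⟩ (`Input.obj`) and its right side as τ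
(`Input.target`). Put λ = log n, ε = √n/λ³, and let B be `discBound`. A feasible program has a point
x of Γ with ⟨w, x⟩ ≤ τ − 19ε/20 (`exists_witness`). The algorithm plays multiplicative weights for
the penalized objective ⟨w, x⟩ + M‖Ax‖ over the cube, with M = 1/(3λ⁴). Each step moves by ±1 along
one uniformly random coordinate, so it reads one column only and costs O(n + k) with the sampling.
After nS steps X/S is nearly in the cube, because each coordinate has been drawn about S times.

The potential is Φ = ⟨w, X⟩ + (M/η) log(total weight). The sign chosen in coordinate j minimizes a
linear bound on the growth of Φ, hence does at least as well as the coordinate x_j of any competitor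
x (`pot_step_le`). Averaged over j, Φ grows by at most (⟨w, x⟩ + MB)/n per step. One-step estimates
of the means of exp(θΦ) and exp(δ|X_l|) multiply along the run (`mean_iterate_le`). By Markov,
outside an event of probability 1/√n, Φ < S(⟨w, x⟩ + MB + ε/5) and all |X_l| ≤ (1 + 1/(10λ³))S.

On that event the output passes (`Input.Valid.passes`). If τ ≥ 0, the zero vector serves. Otherwise
Φ ≥ ⟨w, X⟩ + M‖AX‖ − 2MηnS shows that ⟨w, X⟩ is at most (1 + 1/(10λ³))Sτ < 0, so X rescaled to
objective exactly τ lies in the cube. The same inequality gives M‖AX‖ ≤ −⟨w, X⟩, so the rescaled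
width is at most −τ/M ≤ 2√n/M = 6√n λ⁴.

The error is one-sided: every point is verified before it is output, so a run can only err by
rejecting a feasible program (`ensures_finish`, `mean_incorrect_le`). The remaining work shows that
the machine simulates the abstract process within the time bound and without overflow
(`ensures_move`, `mean_sample_le`, `ensures_oracle`). -/

/-- The mean of `f` under `μ`. -/
noncomputable def mean {α : Type*} (μ : PMF α) (f : α → ℝ≥0∞) : ℝ≥0∞ := ∑' a, μ a * f a

section mean

variable {α β : Type*}

theorem mean_pure (a : α) (f : α → ℝ≥0∞) : mean (PMF.pure a) f = f a := by
  unfold mean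
  rw [tsum_eq_single a]
  · simp
  · intro b hb
    simp [PMF.pure_apply, hb]

theorem mean_bind (μ : PMF α) (κ : α → PMF β) (f : β → ℝ≥0∞) :
    mean (μ.bind κ) f = mean μ fun a => mean (κ a) f := by
  unfold mean
  simp only [PMF.bind_apply, ← ENNReal.tsum_mul_right, ← ENNReal.tsum_mul_left]
  rw [ENNReal.tsum_comm]
  simp only [mul_assoc]

theorem mean_mono {μ : PMF α} {f g : α → ℝ≥0∞} (h : ∀ a ∈ μ.support, f a ≤ g a) :
    mean μ f ≤ mean μ g := by
  refine ENNReal.tsum_le_tsum fun a => ?_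
  by_cases ha : a ∈ μ.support
  · exact mul_le_mul_right (h a ha) _
  · simp [(PMF.apply_eq_zero_iff μ a).2 ha]

theorem mean_const (μ : PMF α) (c : ℝ≥0∞) : mean μ (fun _ => c) = c := by
  unfold mean
  rw [ENNReal.tsum_mul_right, μ.tsum_coe, one_mul]

theorem mean_le {μ : PMF α} {f : α → ℝ≥0∞} {c : ℝ≥0∞} (h : ∀ a ∈ μ.support, f a ≤ c) :
    mean μ f ≤ c :=
  (mean_mono h).trans_eq (mean_const μ c)

theorem mean_add (μ : PMF α) (f g : α → ℝ≥0∞) :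
    mean μ (fun a => f a + g a) = mean μ f + mean μ g := by
  unfold mean
  simp only [mul_add]
  exact ENNReal.tsum_add

theorem mean_sum {ι : Type*} (t : Finset ι) (μ : PMF α) (f : ι → α → ℝ≥0∞) :
    mean μ (fun a => ∑ i ∈ t, f i a) = ∑ i ∈ t, mean μ (f i) := by
  classical
  induction t using Finset.induction_on with
  | empty => simp [mean]
  | insert i t hi ih => simp only [Finset.sum_insert hi, mean_add, ih]

theorem mean_const_mul (μ : PMF α) (c : ℝ≥0∞) (f : α → ℝ≥0∞) :
    mean μ (fun a => c * f a) = c * mean μ f := by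
  unfold mean
  rw [← ENNReal.tsum_mul_left]
  exact tsum_congr fun a => by ring

theorem mean_bernoulli (p : NNReal) (hp : p ≤ 1) (f : Bool → ℝ≥0∞) :
    mean (PMF.bernoulli p hp) f = p * f true + ((1 - p : NNReal) : ℝ≥0∞) * f false := by
  unfold mean
  rw [tsum_bool]
  simp [PMF.bernoulli_apply, add_comm]

/-- Markov's inequality: `f` dominates the indicator of the complement of `S` on the support. -/
theorem toOuterMeasure_ge {μ : PMF α} {S : Set α} {ε : ℝ≥0∞} (f : α → ℝ≥0∞)
    (hf : ∀ a ∈ μ.support, a ∉ S → 1 ≤ f a) (h : mean μ f ≤ ε) : 1 - ε ≤ μ.toOuterMeasure S := by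
  classical
  rw [tsub_le_iff_right, ← μ.tsum_coe, PMF.toOuterMeasure_apply]
  refine le_trans ?_ (add_le_add_right h _)
  unfold mean
  rw [← ENNReal.tsum_add]
  refine ENNReal.tsum_le_tsum fun a => ?_
  by_cases ha : a ∈ S
  · simp [ha]
  · by_cases hs : a ∈ μ.support
    · simp only [ha, not_false_eq_true, Set.indicator_of_notMem, zero_add]
      exact le_mul_of_one_le_right' (hf a hs ha)
    · simp [(PMF.apply_eq_zero_iff μ a).2 hs]

end mean

/-- Every outcome of the run satisfies `Q` and takes at most `t` steps. -/
def Ensures (μ : PMF (Mem × ℕ)) (Q : Mem → Prop) (t : ℕ) : Prop :=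
  ∀ o ∈ μ.support, Q o.1 ∧ o.2 ≤ t

/-! ### Hoare-style rules for postconditions and step counts -/

section ensures

variable {W : ℕ} {s : Mem} {Q R : Mem → Prop} {t u : ℕ}

theorem Ensures.weaken {μ : PMF (Mem × ℕ)} (h : Ensures μ R t) (hQ : ∀ s, R s → Q s) (ht : t ≤ u) :
    Ensures μ Q u :=
  fun o ho => ⟨hQ _ (h o ho).1, (h o ho).2.trans ht⟩

theorem ensures_pure {x : Mem × ℕ} (hQ : Q x.1) (ht : x.2 ≤ t) : Ensures (PMF.pure x) Q t := by
  intro o ho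
  rw [PMF.mem_support_pure_iff] at ho
  subst ho
  exact ⟨hQ, ht⟩

theorem ensures_skip (hQ : Q s) : Ensures (Cmd.skip.run W s) Q 1 :=
  ensures_pure hQ le_rfl

theorem ensures_setInt {a : ℕ} {i e : IExp} (hQ : Q (s.setInt a (i.eval W s) (e.eval W s))) :
    Ensures ((Cmd.setInt a i e).run W s) Q (i.cost + e.cost + 1) :=
  ensures_pure hQ le_rfl

theorem ensures_setReal {a : ℕ} {i : IExp} {e : RExp}
    (hQ : Q (s.setReal a (i.eval W s) (e.eval W s))) :
    Ensures ((Cmd.setReal a i e).run W s) Q (i.cost + e.cost + 1) :=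
  ensures_pure hQ le_rfl

theorem ensures_flip {a : ℕ} {i : IExp} {p : RExp}
    (hQ : ∀ x, x = 0 ∨ x = 1 → Q (s.setInt a (i.eval W s) x)) :
    Ensures ((Cmd.flip a i p).run W s) Q (i.cost + p.cost + 1) := by
  intro o ho
  simp only [Cmd.run, PMF.mem_support_bind_iff, PMF.mem_support_pure_iff] at ho
  obtain ⟨b, -, rfl⟩ := ho
  refine ⟨hQ _ ?_, le_rfl⟩
  cases b <;> simp

theorem Ensures.seq {c d : Cmd} (hc : Ensures (c.run W s) R t)
    (hd : ∀ s', R s' → Ensures (d.run W s') Q u) : Ensures ((Cmd.seq c d).run W s) Q (t + u) := by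
  intro o ho
  simp only [Cmd.run, PMF.mem_support_bind_iff, PMF.mem_support_pure_iff] at ho
  obtain ⟨x, hx, y, hy, rfl⟩ := ho
  have h₁ := hc x hx
  have h₂ := hd x.1 h₁.1 y hy
  exact ⟨h₂.1, Nat.add_le_add h₁.2 h₂.2⟩

theorem Ensures.setInt_seq {a : ℕ} {i e : IExp} {d : Cmd}
    (h : Ensures (d.run W (s.setInt a (i.eval W s) (e.eval W s))) Q t) :
    Ensures ((Cmd.seq (Cmd.setInt a i e) d).run W s) Q (i.cost + e.cost + 1 + t) :=
  Ensures.seq (R := fun s' => s' = s.setInt a (i.eval W s) (e.eval W s)) (ensures_setInt rfl)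
    fun _ hs => hs ▸ h

theorem Ensures.setReal_seq {a : ℕ} {i : IExp} {e : RExp} {d : Cmd}
    (h : Ensures (d.run W (s.setReal a (i.eval W s) (e.eval W s))) Q t) :
    Ensures ((Cmd.seq (Cmd.setReal a i e) d).run W s) Q (i.cost + e.cost + 1 + t) :=
  Ensures.seq (R := fun s' => s' = s.setReal a (i.eval W s) (e.eval W s)) (ensures_setReal rfl)
    fun _ hs => hs ▸ h

theorem ensures_ite {b : BExp} {c d : Cmd} (hc : b.eval W s → Ensures (c.run W s) Q t)
    (hd : ¬ b.eval W s → Ensures (d.run W s) Q t) :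
    Ensures ((Cmd.ite b c d).run W s) Q (t + b.cost + 1) := by
  intro o ho
  simp only [Cmd.run, PMF.mem_support_bind_iff, PMF.mem_support_pure_iff] at ho
  obtain ⟨x, hx, rfl⟩ := ho
  have : Q x.1 ∧ x.2 ≤ t := by
    split_ifs at hx with hb
    · exact hc hb x hx
    · exact hd hb x hx
  exact ⟨this.1, by simpa using this.2⟩

theorem ensures_iterate {body : ℕ → Mem → PMF (Mem × ℕ)} {N : ℕ} (Inv : ℕ → Mem → Prop)
    (h₀ : Inv 0 s) (h : ∀ j < N, ∀ s, Inv j s → Ensures (body j s) (Inv (j + 1)) t) :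
    Ensures (iterate body N s) (Inv N) (N * (t + 1) + 1) := by
  induction N with
  | zero => exact ensures_pure h₀ (by simp)
  | succ N ih =>
    intro o ho
    simp only [iterate, PMF.mem_support_bind_iff, PMF.mem_support_pure_iff] at ho
    obtain ⟨x, hx, y, hy, rfl⟩ := ho
    have h₁ := ih (fun j hj => h j (hj.trans N.lt_succ_self)) x hx
    have h₂ := h N N.lt_succ_self x.1 h₁.1 y hy
    refine ⟨h₂.1, ?_⟩
    have := h₁.2
    have := h₂.2
    simp only
    linarith

theorem ensures_loop {a : ℕ} {e : IExp} {c : Cmd} (Inv : ℕ → Mem → Prop) (N : ℕ)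
    (hN : e.eval W s = N) (h₀ : Inv 0 s)
    (h : ∀ j < N, ∀ s, Inv j s → Ensures (c.run W (s.setInt a 0 j)) (Inv (j + 1)) t) :
    Ensures ((Cmd.loop a e c).run W s) (Inv N) (N * (t + 1) + 1 + e.cost) := by
  intro o ho
  simp only [Cmd.run, PMF.mem_support_bind_iff, PMF.mem_support_pure_iff, hN] at ho
  obtain ⟨x, hx, rfl⟩ := ho
  have := ensures_iterate (body := fun j s' => c.run W (s'.setInt a 0 j)) Inv h₀ h x hx
  exact ⟨this.1, by simpa using this.2⟩

end ensures

/-! ### Means along sequences and loops -/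

section runs

variable {W : ℕ} {s : Mem}

theorem mean_seq (c d : Cmd) (f : Mem → ℝ≥0∞) :
    mean ((Cmd.seq c d).run W s) (fun o => f o.1) =
      mean (c.run W s) fun o => mean (d.run W o.1) fun o' => f o'.1 := by
  simp only [Cmd.run, mean_bind, mean_pure]

theorem mean_loop (a : ℕ) (e : IExp) (c : Cmd) (f : Mem → ℝ≥0∞) :
    mean ((Cmd.loop a e c).run W s) (fun o => f o.1) =
      mean (iterate (fun j s' => c.run W (s'.setInt a 0 j)) (e.eval W s) s) fun o => f o.1 := by
  simp only [Cmd.run, mean_bind, mean_pure]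

theorem mean_iterate_succ (body : ℕ → Mem → PMF (Mem × ℕ)) (N : ℕ) (f : Mem → ℝ≥0∞) :
    mean (iterate body (N + 1) s) (fun o => f o.1) =
      mean (iterate body N s) fun o => mean (body N o.1) fun o' => f o'.1 := by
  simp only [iterate, mean_bind, mean_pure]

/-- A supermartingale argument: conditioned on the memory before each iteration, the mean of `f`
grows by a factor of at most `r`. The invariant restricts this demand to reachable memories. -/
theorem mean_iterate_le {body : ℕ → Mem → PMF (Mem × ℕ)} {N t : ℕ} (Inv : ℕ → Mem → Prop)
    (f : Mem → ℝ≥0∞) (r : ℝ≥0∞) (h₀ : Inv 0 s)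
    (h : ∀ j < N, ∀ s, Inv j s → Ensures (body j s) (Inv (j + 1)) t)
    (hf : ∀ j < N, ∀ s, Inv j s → mean (body j s) (fun o => f o.1) ≤ r * f s) :
    mean (iterate body N s) (fun o => f o.1) ≤ r ^ N * f s := by
  induction N with
  | zero => simp [iterate, mean_pure]
  | succ N ih =>
    have h' : ∀ j < N, ∀ s, Inv j s → Ensures (body j s) (Inv (j + 1)) t :=
      fun j hj => h j (hj.trans N.lt_succ_self)
    rw [mean_iterate_succ]
    calc _ ≤ mean (iterate body N s) fun o => r * f o.1 :=
          mean_mono fun o ho => hf N N.lt_succ_self o.1 (ensures_iterate Inv h₀ h' o ho).1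
      _ = r * mean (iterate body N s) fun o => f o.1 := mean_const_mul _ _ _
      _ ≤ r * (r ^ N * f s) :=
          mul_le_mul_right (ih h' fun j hj => hf j (hj.trans N.lt_succ_self)) _
      _ = r ^ (N + 1) * f s := by ring

end runs

end RealRAM

namespace Oracle

/-! ### Multiplicative weights along random coordinates -/

/-- The accumulated point `X` and the weights `up`, `um` of
the constraints `A x ≤ B` and `-A x ≤ B`. -/
@[ext]
structure State (m n : ℕ) where
  X : Fin n → ℝ
  up : Fin m → ℝ
  um : Fin m → ℝ

namespace State

variable {m n : ℕ} (A : Matrix (Fin m) (Fin n) ℝ) (w : Fin n → ℝ) (η M : ℝ) (σ : State m n)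

/-- The total weight; the trivial constraint `0 ≤ B` has weight `1`. -/
noncomputable def total : ℝ := 1 + ∑ i, σ.up i + ∑ i, σ.um i

/-- The weighted sum of the constraints, in coordinate `j`. -/
noncomputable def grad (j : Fin n) : ℝ := ∑ i, A i j * (σ.up i - σ.um i)

/-- The best response in coordinate `j`. -/
noncomputable def dir (j : Fin n) : ℝ := if w j + M * (σ.grad A j / σ.total) ≤ 0 then 1 else -1

/-- Move along coordinate `j` and update the weights. -/
noncomputable def step (j : Fin n) : State m n where
  X := Function.update σ.X j (σ.X j + σ.dir A w M j)
  up i := σ.up i * (1 + η * σ.dir A w M j * A i j)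
  um i := σ.um i * (1 - η * σ.dir A w M j * A i j)

/-- The weights after `t` steps are at least what the constraints ask for. -/
def Bounded (t : ℕ) : Prop :=
  ∀ i, Real.exp (η * (A *ᵥ σ.X) i - 2 * η ^ 2 * t) ≤ σ.up i ∧
    Real.exp (-(η * (A *ᵥ σ.X) i) - 2 * η ^ 2 * t) ≤ σ.um i

variable {A w η M σ}

theorem abs_dir (j : Fin n) : |σ.dir A w M j| = 1 := by
  unfold dir
  split_ifs <;> simp

theorem dir_mul_le (j : Fin n) {x : ℝ} (hx : |x| ≤ 1) :
    (w j + M * (σ.grad A j / σ.total)) * σ.dir A w M j ≤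
      (w j + M * (σ.grad A j / σ.total)) * x := by
  unfold dir
  have := abs_le.1 hx
  split_ifs with h <;> nlinarith

theorem step_X (j : Fin n) :
    (σ.step A w η M j).X = σ.X + Pi.single j (σ.dir A w M j) := by
  ext l
  by_cases h : l = j
  · subst h; simp [step]
  · simp [step, h]

theorem mulVec_step (j : Fin n) (i : Fin m) :
    (A *ᵥ (σ.step A w η M j).X) i = (A *ᵥ σ.X) i + σ.dir A w M j * A i j := by
  rw [step_X, Matrix.mulVec_add]
  simp [Matrix.mulVec_single, mul_comm]

theorem dotProduct_step (j : Fin n) :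
    w ⬝ᵥ (σ.step A w η M j).X = w ⬝ᵥ σ.X + w j * σ.dir A w M j := by
  rw [step_X, dotProduct_add, dotProduct_single]

theorem total_step (j : Fin n) :
    (σ.step A w η M j).total = σ.total + η * σ.dir A w M j * σ.grad A j := by
  simp only [total, grad, step, mul_add, mul_sub, mul_one, Finset.sum_add_distrib,
    Finset.sum_sub_distrib, Finset.mul_sum]
  have h₁ : ∑ i, σ.up i * (η * σ.dir A w M j * A i j) =
      ∑ i, η * σ.dir A w M j * (A i j * σ.up i) := Finset.sum_congr rfl fun i _ => by ring
  have h₂ : ∑ i, σ.um i * (η * σ.dir A w M j * A i j) =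
      ∑ i, η * σ.dir A w M j * (A i j * σ.um i) := Finset.sum_congr rfl fun i _ => by ring
  rw [h₁, h₂]
  ring

/-- Take reciprocals and use 1 + t ≤ exp t; what remains is (1 + z)(1 − z + 2z²) = 1 + z²(1 + 2z) ≥
1. This is the only second-order loss in passing from product weights to exponential ones. -/
theorem exp_sub_le_one_add {z : ℝ} (hz : -(1 / 2) ≤ z) : Real.exp (z - 2 * z ^ 2) ≤ 1 + z := by
  have h := Real.add_one_le_exp (-(z - 2 * z ^ 2))
  have h₁ : 0 < 1 - z + 2 * z ^ 2 := by nlinarith [sq_nonneg (z - 1 / 4)]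
  rw [← neg_neg (z - 2 * z ^ 2), Real.exp_neg]
  calc (Real.exp (-(z - 2 * z ^ 2)))⁻¹ ≤ (1 - z + 2 * z ^ 2)⁻¹ :=
        inv_anti₀ h₁ (by linarith)
    _ ≤ 1 + z := by
        rw [inv_le_iff_one_le_mul₀ h₁]
        nlinarith [mul_nonneg (sq_nonneg z) (by linarith : 0 ≤ 1 + 2 * z)]

theorem exp_le_one_add_sq {z : ℝ} (hz : |z| ≤ 1) : Real.exp z ≤ 1 + z + z ^ 2 := by
  have := abs_le.1 (Real.abs_exp_sub_one_sub_id_le hz)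
  linarith [this.2]

theorem Bounded.pos {t : ℕ} (h : σ.Bounded A η t) (i : Fin m) : 0 < σ.up i ∧ 0 < σ.um i :=
  ⟨(Real.exp_pos _).trans_le (h i).1, (Real.exp_pos _).trans_le (h i).2⟩

theorem Bounded.step {t : ℕ} (h : σ.Bounded A η t) (hA : ∀ i j, |A i j| ≤ 1) (hη₀ : 0 ≤ η)
    (hη : η ≤ 1 / 2) (j : Fin n) : (σ.step A w η M j).Bounded A η (t + 1) := by
  intro i
  have hz : |η * σ.dir A w M j * A i j| ≤ η := by
    rw [abs_mul, abs_mul, abs_dir, abs_of_nonneg hη₀, mul_one]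
    exact mul_le_of_le_one_right hη₀ (hA i j)
  rw [mulVec_step]
  simp only [State.step]
  set z := η * σ.dir A w M j * A i j with hzdef
  have hz' := abs_le.1 hz
  have hsq : z ^ 2 ≤ η ^ 2 := sq_le_sq' hz'.1 hz'.2
  have h₁ := exp_sub_le_one_add (z := z) (by linarith)
  have h₂ := exp_sub_le_one_add (z := -z) (by linarith)
  constructor
  · calc Real.exp (η * ((A *ᵥ σ.X) i + σ.dir A w M j * A i j) - 2 * η ^ 2 * (t + 1 : ℕ))
        ≤ Real.exp ((η * (A *ᵥ σ.X) i - 2 * η ^ 2 * t) + (z - 2 * z ^ 2)) := by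
          rw [Real.exp_le_exp, hzdef]; push_cast; rw [← hzdef]
          have : η * ((A *ᵥ σ.X) i + σ.dir A w M j * A i j) = η * (A *ᵥ σ.X) i + z := by
            rw [hzdef]; ring
          linarith
      _ ≤ _ := by
          rw [Real.exp_add]
          exact mul_le_mul (h i).1 h₁ (Real.exp_pos _).le (h.pos i).1.le
  · calc Real.exp (-(η * ((A *ᵥ σ.X) i + σ.dir A w M j * A i j)) - 2 * η ^ 2 * (t + 1 : ℕ))
        ≤ Real.exp ((-(η * (A *ᵥ σ.X) i) - 2 * η ^ 2 * t) + (-z - 2 * (-z) ^ 2)) := by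
          rw [Real.exp_le_exp]; push_cast
          have : η * ((A *ᵥ σ.X) i + σ.dir A w M j * A i j) = η * (A *ᵥ σ.X) i + z := by
            rw [hzdef]; ring
          nlinarith
      _ ≤ _ := by
          rw [Real.exp_add, sub_eq_add_neg 1 z]
          exact mul_le_mul (h i).2 h₂ (Real.exp_pos _).le (h.pos i).2.le

theorem one_le_total (hup : ∀ i, 0 < σ.up i ∧ 0 < σ.um i) : 1 ≤ σ.total := by
  have h₁ := Finset.sum_nonneg fun i (_ : i ∈ Finset.univ) => (hup i).1.le
  have h₂ := Finset.sum_nonneg fun i (_ : i ∈ Finset.univ) => (hup i).2.le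
  unfold total
  linarith

/-- Used twice: with `z` a column of `A`, to bound the gradient, and with `z` the product of `A`
with the competitor, to bound its penalty by `B`. -/
theorem abs_sum_weights_le (hup : ∀ i, 0 < σ.up i ∧ 0 < σ.um i) {z : Fin m → ℝ} {B : ℝ}
    (hB : 0 ≤ B) (hz : ∀ i, |z i| ≤ B) : |∑ i, z i * (σ.up i - σ.um i)| ≤ B * σ.total := by
  calc |∑ i, z i * (σ.up i - σ.um i)| ≤ ∑ i, |z i * (σ.up i - σ.um i)| :=
        Finset.abs_sum_le_sum_abs _ _
    _ ≤ ∑ i, B * (σ.up i + σ.um i) := by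
        refine Finset.sum_le_sum fun i _ => ?_
        rw [abs_mul]
        refine mul_le_mul (hz i) ?_ (abs_nonneg _) hB
        have := hup i
        rw [abs_le]; constructor <;> linarith
    _ ≤ B * σ.total := by
        rw [← Finset.mul_sum, Finset.sum_add_distrib]
        refine mul_le_mul_of_nonneg_left ?_ hB
        unfold total; linarith

/-- The potential that bounds `w ⬝ᵥ X + M ‖A X‖`. -/
noncomputable def pot (w : Fin n → ℝ) (η M θ : ℝ) (σ : State m n) : ℝ :=
  Real.exp (θ * (w ⬝ᵥ σ.X + M / η * Real.log σ.total))

/-- The total weight is exactly linear in the move, so log(1 + y) ≤ y bounds the growth of the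
potential by a linear function of the sign. The chosen sign minimizes that function over [-1, 1]. -/
theorem pot_step_le (hup : ∀ i, 0 < σ.up i ∧ 0 < σ.um i) (hA : ∀ i j, |A i j| ≤ 1) {θ : ℝ}
    (hη₀ : 0 < η) (hη : η ≤ 1 / 2) (hθ : 0 ≤ θ) (hM : 0 ≤ M) (j : Fin n) {x : ℝ} (hx : |x| ≤ 1) :
    pot w η M θ (σ.step A w η M j) ≤
      pot w η M θ σ * Real.exp (θ * ((w j + M * (σ.grad A j / σ.total)) * x)) := by
  unfold pot
  rw [← Real.exp_add, Real.exp_le_exp, ← mul_add]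
  refine mul_le_mul_of_nonneg_left ?_ hθ
  have ht := one_le_total hup
  have ht₀ : 0 < σ.total := by linarith
  have hg : |σ.grad A j| ≤ σ.total := by
    simpa [grad] using abs_sum_weights_le hup zero_le_one fun i => hA i j
  set μ := σ.grad A j / σ.total with hμ
  have hgμ : σ.grad A j = σ.total * μ := by rw [hμ]; field_simp
  have hμ1 : |μ| ≤ 1 := by
    rw [hμ, abs_div, abs_of_pos ht₀]; exact div_le_one_of_le₀ hg ht₀.le
  have hdμ : |η * σ.dir A w M j * μ| ≤ 1 / 2 := by
    rw [abs_mul, abs_mul, abs_dir, abs_of_pos hη₀, mul_one]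
    exact (mul_le_of_le_one_right hη₀.le hμ1).trans hη
  have hpos : 0 < 1 + η * σ.dir A w M j * μ := by linarith [(abs_le.1 hdμ).1]
  have hlog : Real.log (σ.step A w η M j).total ≤
      Real.log σ.total + η * σ.dir A w M j * μ := by
    rw [total_step, hgμ, show σ.total + η * σ.dir A w M j * (σ.total * μ) =
      σ.total * (1 + η * σ.dir A w M j * μ) by ring, Real.log_mul ht₀.ne' hpos.ne']
    have := Real.log_le_sub_one_of_pos hpos
    linarith
  have hdir := dir_mul_le (σ := σ) (A := A) (w := w) (M := M) j hx
  rw [← hμ] at hdir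
  rw [dotProduct_step]
  have h₁ : M / η * Real.log (σ.step A w η M j).total ≤
      M / η * Real.log σ.total + M * σ.dir A w M j * μ := by
    calc _ ≤ M / η * (Real.log σ.total + η * σ.dir A w M j * μ) :=
          mul_le_mul_of_nonneg_left hlog (by positivity)
      _ = _ := by field_simp
  nlinarith

/-- The potential grows slowly on average, whichever point `x` one compares with. -/
theorem avg_pot_step_le (hn : 0 < n) (hup : ∀ i, 0 < σ.up i ∧ 0 < σ.um i)
    (hA : ∀ i j, |A i j| ≤ 1) (hw : ∀ j, |w j| ≤ 2) {θ B : ℝ} (hη₀ : 0 < η) (hη : η ≤ 1 / 2)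
    (hθ : 0 ≤ θ) (hθ' : 3 * θ ≤ 1) (hM : 0 ≤ M) (hM' : M ≤ 1) {x : Fin n → ℝ}
    (hx : ∀ j, |x j| ≤ 1) (hB : 0 ≤ B) (hAx : ∀ i, |(A *ᵥ x) i| ≤ B) :
    (∑ j, pot w η M θ (σ.step A w η M j)) / n ≤
      Real.exp (θ * (w ⬝ᵥ x + M * B) / n + 9 * θ ^ 2) * pot w η M θ σ := by
  have ht := one_le_total hup
  have ht₀ : 0 < σ.total := by linarith
  have hn' : (0 : ℝ) < n := by exact_mod_cast hn
  set p : Fin n → ℝ := fun j => w j + M * (σ.grad A j / σ.total) with hp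
  have hp3 : ∀ j, |p j * x j| ≤ 3 := by
    intro j
    have hg : |σ.grad A j| ≤ σ.total := by
      simpa [grad] using abs_sum_weights_le hup zero_le_one fun i => hA i j
    have : |σ.grad A j / σ.total| ≤ 1 := by
      rw [abs_div, abs_of_pos ht₀]; exact div_le_one_of_le₀ hg ht₀.le
    have h3 : |p j| ≤ 3 := by
      calc |p j| ≤ |w j| + |M * (σ.grad A j / σ.total)| := abs_add_le _ _
        _ ≤ 2 + 1 := by
            refine add_le_add (hw j) ?_
            rw [abs_mul, abs_of_nonneg hM]
            exact mul_le_one₀ hM' (abs_nonneg _) this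
        _ = 3 := by norm_num
    rw [abs_mul]
    calc |p j| * |x j| ≤ 3 * 1 := mul_le_mul h3 (hx j) (abs_nonneg _) (by norm_num)
      _ = 3 := by norm_num
  -- The bound 3 on |p j * x j| gives the quadratic term 9θ². Linearizing here lets the average over
  -- j pass inside.
  have hexp : ∀ j, Real.exp (θ * (p j * x j)) ≤ 1 + θ * (p j * x j) + 9 * θ ^ 2 := by
    intro j
    have h1 : |θ * (p j * x j)| ≤ 3 * θ := by
      rw [abs_mul, abs_of_nonneg hθ]; nlinarith [hp3 j]
    have h2 := exp_le_one_add_sq (h1.trans hθ')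
    have h3 : (θ * (p j * x j)) ^ 2 ≤ (3 * θ) ^ 2 := sq_le_sq' (abs_le.1 h1).1 (abs_le.1 h1).2
    nlinarith
  have hsum : ∑ j, p j * x j ≤ w ⬝ᵥ x + M * B := by
    -- Exchanging the sums turns the gradient term into a weighted average of the constraints at x,
    -- which is at most B.
    have hswap : ∑ j, σ.grad A j * x j = ∑ i, (A *ᵥ x) i * (σ.up i - σ.um i) := by
      simp only [grad, Matrix.mulVec, dotProduct, Finset.sum_mul]
      rw [Finset.sum_comm]
      exact Finset.sum_congr rfl fun i _ => Finset.sum_congr rfl fun j _ => by ring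
    have h1 : ∑ j, p j * x j = w ⬝ᵥ x + M * ((∑ j, σ.grad A j * x j) / σ.total) := by
      simp only [hp, add_mul, Finset.sum_add_distrib, dotProduct, Finset.sum_div, Finset.mul_sum]
      congr 1
      exact Finset.sum_congr rfl fun j _ => by ring
    rw [h1, hswap]
    have h2 := (abs_le.1 (abs_sum_weights_le hup hB hAx)).2
    have h3 : (∑ i, (A *ᵥ x) i * (σ.up i - σ.um i)) / σ.total ≤ B := by
      rwa [div_le_iff₀ ht₀]
    have := mul_le_mul_of_nonneg_left h3 hM
    linarith
  have hpos : 0 < pot w η M θ σ := Real.exp_pos _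
  calc (∑ j, pot w η M θ (σ.step A w η M j)) / n
      ≤ (∑ j, pot w η M θ σ * (1 + θ * (p j * x j) + 9 * θ ^ 2)) / n := by
        gcongr with j
        exact (pot_step_le hup hA hη₀ hη hθ hM j (hx j)).trans
          (mul_le_mul_of_nonneg_left (hexp j) hpos.le)
    _ = (1 + θ * (∑ j, p j * x j) / n + 9 * θ ^ 2) * pot w η M θ σ := by
        rw [← Finset.mul_sum, Finset.sum_add_distrib, Finset.sum_add_distrib, ← Finset.mul_sum]
        simp only [Finset.sum_const, Finset.card_univ, Fintype.card_fin, nsmul_eq_mul]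
        field_simp
    _ ≤ _ := by
        refine mul_le_mul_of_nonneg_right ?_ hpos.le
        have h1 : θ * (∑ j, p j * x j) / n ≤ θ * (w ⬝ᵥ x + M * B) / n := by gcongr
        have h2 := Real.add_one_le_exp (θ * (w ⬝ᵥ x + M * B) / n + 9 * θ ^ 2)
        linarith

/-- No coordinate moves far. -/
theorem avg_exp_abs_step_le (hn : 0 < n) {δ : ℝ} (hδ₀ : 0 ≤ δ) (hδ : δ ≤ 1) (l : Fin n) :
    (∑ j, Real.exp (δ * |(σ.step A w η M j).X l|)) / n ≤
      Real.exp ((δ + δ ^ 2) / n) * Real.exp (δ * |σ.X l|) := by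
  have hn' : (0 : ℝ) < n := by exact_mod_cast hn
  -- Only the draw j = l changes this coordinate, and by at most 1; that draw contributes the 1/n in
  -- the exponent.
  have h1 : ∀ j, Real.exp (δ * |(σ.step A w η M j).X l|) ≤
      Real.exp (δ * |σ.X l|) * (1 + if j = l then δ + δ ^ 2 else 0) := by
    intro j
    split_ifs with h
    · subst h
      have h2 : |(σ.step A w η M j).X j| ≤ |σ.X j| + 1 := by
        simp only [step, Function.update_self]
        exact (abs_add_le _ _).trans_eq (by rw [abs_dir])
      calc Real.exp (δ * |(σ.step A w η M j).X j|) ≤ Real.exp (δ * |σ.X j| + δ) := by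
            rw [Real.exp_le_exp]; nlinarith
        _ = Real.exp (δ * |σ.X j|) * Real.exp δ := Real.exp_add _ _
        _ ≤ _ := by
            refine mul_le_mul_of_nonneg_left ?_ (Real.exp_pos _).le
            have := exp_le_one_add_sq (z := δ) (by rwa [abs_of_nonneg hδ₀])
            linarith
    · simp [step, Function.update_of_ne (Ne.symm h)]
  calc (∑ j, Real.exp (δ * |(σ.step A w η M j).X l|)) / n
      ≤ (∑ j, Real.exp (δ * |σ.X l|) * (1 + if j = l then δ + δ ^ 2 else 0)) / n := by
        gcongr with j
        exact h1 j
    _ = (1 + (δ + δ ^ 2) / n) * Real.exp (δ * |σ.X l|) := by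
        rw [← Finset.mul_sum, Finset.sum_add_distrib]
        simp only [Finset.sum_const, Finset.card_univ, Fintype.card_fin, nsmul_eq_mul,
          Finset.sum_ite_eq', Finset.mem_univ, if_true]
        field_simp
    _ ≤ _ := by
        refine mul_le_mul_of_nonneg_right ?_ (Real.exp_pos _).le
        have := Real.add_one_le_exp ((δ + δ ^ 2) / (n : ℝ))
        linarith

/-- A single weight is at most the total, so the log of the total weight is a soft maximum of the
constraints. The drift 2ηt is the accumulated second-order loss. -/
theorem Bounded.abs_le_log {t : ℕ} (h : σ.Bounded A η t) (hη₀ : 0 < η) (i : Fin m) :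
    |(A *ᵥ σ.X) i| ≤ Real.log σ.total / η + 2 * η * t := by
  have hup := fun i => h.pos i
  have key : ∀ z, Real.exp (z - 2 * η ^ 2 * t) ≤ σ.total →
      z ≤ Real.log σ.total + 2 * η ^ 2 * t := by
    intro z hz
    have := Real.log_le_log (Real.exp_pos _) hz
    rw [Real.log_exp] at this
    linarith
  have h1 := Finset.single_le_sum (f := σ.up) (fun i _ => (hup i).1.le) (Finset.mem_univ i)
  have h2 := Finset.single_le_sum (f := σ.um) (fun i _ => (hup i).2.le) (Finset.mem_univ i)
  have h3 := Finset.sum_nonneg fun i (_ : i ∈ Finset.univ) => (hup i).1.le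
  have h4 := Finset.sum_nonneg fun i (_ : i ∈ Finset.univ) => (hup i).2.le
  have h5 := key _ ((h i).1.trans (by unfold total; linarith))
  have h6 := key _ ((h i).2.trans (by unfold total; linarith))
  have h7 : η * |(A *ᵥ σ.X) i| ≤ Real.log σ.total + 2 * η ^ 2 * t := by
    rcases abs_cases ((A *ᵥ σ.X) i) with ⟨e, _⟩ | ⟨e, _⟩ <;> rw [e] <;> linarith
  have h8 : Real.log σ.total / η + 2 * η * t = (Real.log σ.total + 2 * η ^ 2 * t) / η := by
    field_simp
  rw [h8, le_div_iff₀ hη₀]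
  linarith

end State

end Oracle

namespace RealRAM

/-! ### Compressed sparse columns -/

namespace Columns

variable {m n : ℕ} {A : Matrix (Fin m) (Fin n) ℝ} (L : Columns A)

/-- The number of nonzero entries of column `j`. -/
def len (j : ℕ) : ℕ := L.ptr (j + 1) - L.ptr j

theorem ptr_add_mem (j : Fin n) {q : ℕ} (hq : q < L.len j) :
    L.ptr j + q ∈ Set.Ico (L.ptr j) (L.ptr ((j : ℕ) + 1)) := by
  unfold len at hq
  constructor <;> omega

theorem exists_row (j : Fin n) {q : ℕ} (hq : q < L.len j) :
    ∃ i : Fin m, L.row (L.ptr j + q) = i ∧ A i j ≠ 0 ∧ L.val (L.ptr j + q) = A i j := by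
  have h := L.ptr_add_mem j hq
  obtain ⟨i, hi, hA⟩ := (L.row_bijOn j).mapsTo h
  exact ⟨i, hi.symm, hA, L.val_eq j i _ h hi.symm⟩

theorem row_inj (j : Fin n) {q q' : ℕ} (hq : q < L.len j) (hq' : q' < L.len j)
    (h : L.row (L.ptr j + q) = L.row (L.ptr j + q')) : q = q' := by
  have := (L.row_bijOn j).injOn (L.ptr_add_mem j hq) (L.ptr_add_mem j hq') h
  omega

theorem exists_row_eq_iff (j : Fin n) (i : Fin m) :
    (∃ q < L.len j, L.row (L.ptr j + q) = i) ↔ A i j ≠ 0 := by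
  constructor
  · rintro ⟨q, hq, h⟩
    obtain ⟨i', hi', hA, -⟩ := L.exists_row j hq
    rw [hi'] at h
    rwa [← Fin.ext h]
  · intro hA
    obtain ⟨p, hp, hpi⟩ := (L.row_bijOn j).surjOn ⟨i, rfl, hA⟩
    refine ⟨p - L.ptr j, ?_, ?_⟩
    · unfold len
      have := hp.1
      have := hp.2
      omega
    · rw [Nat.add_sub_cancel' hp.1, hpi]

theorem sum_eq (j : Fin n) (g : ℕ → ℝ) :
    ∑ q ∈ Finset.range (L.len j), L.val (L.ptr j + q) * g (L.row (L.ptr j + q)) =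
      ∑ i : Fin m, A i j * g i := by
  classical
  have h : ∀ q : Fin (L.len j), ∃ i : Fin m, L.row (L.ptr j + q) = i ∧ A i j ≠ 0 ∧
      L.val (L.ptr j + q) = A i j := fun q => L.exists_row j q.2
  choose f hf hA hval using h
  rw [← Finset.sum_filter_of_ne (p := fun i => A i j ≠ 0) (fun i _ hi => left_ne_zero_of_mul hi),
    Finset.sum_range]
  refine Finset.sum_bij (fun q _ => f q) (fun q _ => by simp [hA q]) ?_ ?_ ?_
  · intro q _ q' _ hqq
    exact Fin.ext (L.row_inj j q.2 q'.2 (by rw [hf, hf, hqq]))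
  · intro i hi
    obtain ⟨q, hq, hqi⟩ := (L.exists_row_eq_iff j i).2 (by simpa using hi)
    exact ⟨⟨q, hq⟩, Finset.mem_univ _, Fin.ext (by rw [← hf, hqi])⟩
  · intro q _
    rw [hval, hf]

theorem len_eq (j : Fin n) : L.len j = {i | A i j ≠ 0}.ncard := by
  have h1 := (L.row_bijOn j).ncard_eq
  have h2 : {r | ∃ i : Fin m, (i : ℕ) = r ∧ A i j ≠ 0} = Fin.val '' {i | A i j ≠ 0} := by
    ext r
    simp [and_comm]
  rw [h2, Set.ncard_image_of_injective _ Fin.val_injective] at h1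
  rw [← h1, len, ← Finset.coe_Ico, Set.ncard_coe_finset, Nat.card_Ico]

/-- A column has at most `m` nonzero entries. This keeps all positions in the sparse format below
the word bound. -/
theorem ptr_le_mul {j : ℕ} (hj : j ≤ n) : L.ptr j ≤ j * m := by
  induction j with
  | zero => simp [L.ptr_zero]
  | succ j ih =>
    have h1 := L.len_eq ⟨j, hj⟩
    have h2 : {i | A i ⟨j, hj⟩ ≠ 0}.ncard ≤ m := by
      simpa using Set.ncard_le_card {i | A i ⟨j, hj⟩ ≠ 0}
    have h3 := ih (Nat.le_of_succ_le hj)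
    have h4 := L.ptr_le ⟨j, hj⟩
    rw [← h1] at h2
    simp only [len] at h2 h4
    rw [Nat.succ_mul]
    omega

end Columns

end RealRAM

namespace Oracle

open RealRAM

/-- A machine with long words. -/
structure BigWords (W n m : ℕ) : Prop where
  row : n * m + n + m + 1 < W
  dbl : 2 * n + 1 < W
  iter : ∀ l ≤ 2 * n, n * (1000 * l ^ 7) < W

/-! ### The program -/

namespace Prog

/-- Cell `0` of an integer array. -/
def iv (a : ℕ) : IExp := .get a (.lit 0)

/-- Cell `0` of a real array. -/
def rv (a : ℕ) : RExp := .get a (.lit 0)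

def nE : IExp := iv 0
def mE : IExp := .get 0 (.lit 1)
def sqrtE : RExp := .sqrt (.ofInt nE)
def logE : RExp := .log (.ofInt nE)
def cubeE (e : RExp) : RExp := .mul e (.mul e e)
def fourthE (e : RExp) : RExp := .mul e (cubeE e)
/-- The step size of the weights. -/
def etaE : RExp := .div (.lit 1) sqrtE
/-- The price of a violated constraint. -/
def priceE : RExp := .div (.lit 1) (.mul (.lit 3) (fourthE logE))

/-- A step of reservoir sampling. -/
def reservoir : Cmd :=
  .seq (.flip 10 (.lit 0) (.div (.lit 1) (.add (.ofInt (iv 8)) (.lit 1))))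
    (.ite (.ile (.lit 1) (iv 10)) (.setInt 9 (.lit 0) (iv 8)) .skip)

/-- `int 9 [0]` becomes uniform on `{0, …, n - 1}`. -/
def sample : Cmd := .loop 8 nE reservoir

/-- The length of column `int 9 [0]`. -/
def lenE : IExp := .sub (.get 1 (.add (iv 9) (.lit 1))) (.get 1 (iv 9))
def rowE : IExp := .get 2 (iv 12)
def valE : RExp := .get 1 (iv 12)
def locate : Cmd := .setInt 12 (.lit 0) (.add (.get 1 (iv 9)) (iv 11))

/-- `real 12 [0]` and `real 13 [0]` become the coordinates of the objective and of the weighted sum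
of the constraints. -/
def gather : Cmd :=
  .loop 11 lenE
    (.seq locate
      (.seq
        (.setReal 12 (.lit 0) (.add (rv 12)
          (.mul valE (.sub (.get 2 rowE) (.get 3 rowE)))))
        (.setReal 13 (.lit 0) (.add (rv 13)
          (.mul valE (.sub (.get 8 rowE) (.get 9 rowE)))))))

/-- Update the weights and `A X` along the column. -/
def scatter : Cmd :=
  .loop 11 lenE
    (.seq locate
      (.seq (.setReal 7 rowE (.add (.get 7 rowE) (.mul (rv 14) valE)))
        (.seq
          -- The cells hold the weights minus one, so zero-initialized memory already represents
          -- unit weights.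
          (.setReal 8 rowE (.sub (.mul (.add (.lit 1) (.get 8 rowE))
            (.add (.lit 1) (.mul (.mul etaE (rv 14)) valE))) (.lit 1)))
          (.setReal 9 rowE (.sub (.mul (.add (.lit 1) (.get 9 rowE))
            (.sub (.lit 1) (.mul (.mul etaE (rv 14)) valE))) (.lit 1))))))

/-- A step of the algorithm along coordinate `int 9 [0]`. -/
def move : Cmd :=
  .seq (.setReal 12 (.lit 0)
    (.sub (.lit 0) (.div (.mul (.get 0 (.lit 1)) (.get 4 (iv 9))) sqrtE)))
  (.seq (.setReal 13 (.lit 0) (.lit 0))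
  (.seq gather
  (.seq (.ite (.rle (.add (rv 12) (.mul priceE (.div (rv 13) (.add (.lit 1) (rv 10))))) (.lit 0))
    (.setReal 14 (.lit 0) (.lit 1)) (.setReal 14 (.lit 0) (.sub (.lit 0) (.lit 1))))
  (.seq scatter
  (.seq (.setReal 6 (iv 9) (.add (.get 6 (iv 9)) (rv 14)))
  (.seq (.setReal 11 (.lit 0) (.add (rv 11) (.mul (rv 12) (rv 14))))
  (.setReal 10 (.lit 0) (.add (rv 10) (.mul (.mul etaE (rv 14)) (rv 13))))))))))

/-- `int 4 [0]` becomes an upper bound for the binary logarithm of `n`. -/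
def prepare : Cmd :=
  .seq (.setInt 5 (.lit 0) (.lit 1))
  (.seq (.loop 6 nE (.ite (.ile nE (iv 5)) .skip
    (.seq (.setInt 5 (.lit 0) (.add (iv 5) (iv 5))) (.setInt 4 (.lit 0) (.add (iv 4) (.lit 1))))))
  -- The cell holds the total weight without the 1 of the trivial constraint: initially 2m unit
  -- weights.
  (.setReal 10 (.lit 0) (.add (.ofInt mE) (.ofInt mE))))

/-- This is nS with S = 1000ℓ⁷ and λ ≤ ℓ ≤ 2λ. Both tail exponents are of order S/λ⁶ and must exceed
a multiple of λ, hence the seventh power. -/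
def iterE : IExp := .mul nE (.mul (.lit 1000) (.mul (iv 4) (.mul (iv 4) (.mul (iv 4) (.mul (iv 4)
  (.mul (iv 4) (.mul (iv 4) (iv 4))))))))

def mainLoop : Cmd := .loop 7 iterE (.seq sample move)

/-- The bound that the output has to satisfy. -/
def targetE : RExp :=
  .add (.add (.sub (.lit 0) (.mul (.get 0 (.lit 1)) (.get 0 (.lit 2))))
    (.mul (.mul (.get 0 (.lit 0)) (.sqrt (.mul (.ofInt nE)
      (.log (.add (.div (.ofInt mE) (.ofInt nE)) (.lit 2))))))
      (.sub (.lit 1) (.get 0 (.lit 1)))))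
    (.div sqrtE (cubeE logE))

/-- `int 3 [0]` becomes `0` unless `|e| ≤ f`. -/
def check (e f : RExp) : Cmd :=
  .ite (.and (.rle e f) (.rle (.sub (.lit 0) f) e)) .skip (.setInt 3 (.lit 0) (.lit 0))

/-- The zero vector is output when the target is nonnegative. Otherwise X is scaled to meet the
target with equality, which leaves only the cube and the width to be tested, from the maintained
product with `A`. -/
def finish : Cmd :=
  .seq (.setInt 3 (.lit 0) (.lit 1))
  (.seq (.setReal 15 (.lit 0) targetE)
  (.ite (.rle (.lit 0) (rv 15)) .skip
    (.ite (.rle (.lit 0) (rv 11)) (.setInt 3 (.lit 0) (.lit 0))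
      (.seq (.setReal 16 (.lit 0) (.div (rv 15) (rv 11)))
      (.seq (.loop 13 nE (.seq (.setReal 5 (iv 13) (.mul (.get 6 (iv 13)) (rv 16)))
        (check (.get 5 (iv 13)) (.lit 1))))
      (.loop 13 mE (check (.mul (.get 7 (iv 13)) (rv 16))
        (.mul (.mul (.lit 10) sqrtE) (fourthE logE)))))))))

/-- The whole algorithm. -/
def oracle : Cmd := .seq prepare (.seq mainLoop finish)

end Prog

attribute [local simp] IExp.eval RExp.eval BExp.eval Prog.iv Prog.rv Prog.nE Prog.mE Prog.sqrtE
  Prog.logE Prog.cubeE Prog.fourthE Prog.etaE Prog.priceE Prog.rowE Prog.valE Prog.lenE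
  Mem.setInt Mem.setReal

theorem BigWords.one_mod {W n m : ℕ} (hW : BigWords W n m) : 1 % W = 1 :=
  Nat.mod_eq_of_lt (by have := hW.row; omega)

/-! ### Sampling a coordinate -/

/-- `s'` is `s` up to the cells used by the sampler, whose result is `j`. -/
structure Sampled (s : Mem) (j : ℕ) (s' : Mem) : Prop where
  real_eq : s'.real = s.real
  int_eq : ∀ a, a ≠ 8 → a ≠ 9 → a ≠ 10 → s'.int a = s.int a
  result : s'.int 9 0 = j

section sample

variable {W n m : ℕ} {s : Mem}

theorem ensures_reservoir {N : ℕ} (hN : N < n) {s₁ : Mem} (hs₁ : ∃ j < n, Sampled s j s₁) :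
    Ensures (Prog.reservoir.run W (s₁.setInt 8 0 N)) (fun s' => ∃ j < n, Sampled s j s') 19 := by
  obtain ⟨j, hj, hs⟩ := hs₁
  refine Ensures.weaken (u := 19) (Ensures.seq (t := 9) (u := 9)
    (R := fun s' => Sampled s j s' ∧ s'.int 8 0 = N) ((ensures_flip ?_).weaken (fun _ h => h) ?_)
    ?_) (fun _ h => h) (by norm_num)
  · intro x _
    refine ⟨⟨?_, ?_, ?_⟩, ?_⟩
    · simpa using hs.real_eq
    · intro a h1 h2 h3
      simpa [h1, h3] using hs.int_eq a h1 h2 h3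
    · simpa using hs.result
    · simp
  · simp [IExp.cost, RExp.cost]
  · rintro s₂ ⟨hs₂, h8⟩
    refine Ensures.weaken (ensures_ite (t := 4) ?_ ?_) (fun _ h => h) (by simp [BExp.cost, IExp.cost])
    · intro _
      refine (ensures_setInt ?_).weaken (fun _ h => h) (by simp [IExp.cost])
      refine ⟨N, hN, ?_, ?_, ?_⟩
      · simpa using hs₂.real_eq
      · intro a h1 h2 h3
        simpa [h2] using hs₂.int_eq a h1 h2 h3
      · simp [h8]
    · intro _
      exact (ensures_skip ⟨j, hj, hs₂⟩).weaken (fun _ h => h) (by norm_num)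

theorem ensures_sample (hn : s.int 0 0 = n) (h9 : s.int 9 0 < n) :
    Ensures (Prog.sample.run W s) (fun s' => ∃ j < n, Sampled s j s') (n * 20 + 3) :=
  (ensures_loop (fun _ s' => ∃ j < n, Sampled s j s') n (by simp [hn])
    ⟨_, h9, rfl, fun _ _ _ _ => rfl, rfl⟩ fun _ hN _ hs => ensures_reservoir hN hs).weaken
    (fun _ hs => hs) (by simp [IExp.cost])

theorem mean_reservoir_le (h1 : 1 % W = 1) {N : ℕ} {f : Mem → ℝ≥0∞} {s₁ : Mem} {j : ℕ}
    {g : ℕ → ℝ≥0∞} (hs : Sampled s j s₁) (h : ∀ j s', Sampled s j s' → f s' ≤ g j) :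
    mean (Prog.reservoir.run W (s₁.setInt 8 0 N)) (fun o => f o.1) ≤
      ENNReal.ofReal (1 / (N + 1)) * g N + ENNReal.ofReal (N / (N + 1)) * g j := by
  have hN : (0 : ℝ) < N + 1 := by positivity
  have e1 : ((min (1 / ((N : ℝ) + 1)).toNNReal 1 : NNReal) : ℝ≥0∞) =
      ENNReal.ofReal (1 / (N + 1)) := by
    rw [min_eq_left]
    · rfl
    · rw [Real.toNNReal_le_one, div_le_one hN]; linarith [(Nat.cast_nonneg N : (0 : ℝ) ≤ N)]
  have e2 : ((1 - min (1 / ((N : ℝ) + 1)).toNNReal 1 : NNReal) : ℝ≥0∞) =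
      ENNReal.ofReal (N / (N + 1)) := by
    rw [ENNReal.coe_sub, e1, ENNReal.coe_one, ← ENNReal.ofReal_one,
      ← ENNReal.ofReal_sub _ (by positivity)]
    congr 1
    field_simp
    ring
  rw [Prog.reservoir, mean_seq]
  simp only [Cmd.run, mean_bind, mean_pure, mean_bernoulli]
  simp [h1, mean_pure, -one_div, e1, e2]
  refine add_le_add (mul_le_mul_right (h N _ ⟨?_, ?_, ?_⟩) _)
    (mul_le_mul_right (h j _ ⟨?_, ?_, ?_⟩) _)
  · exact hs.real_eq
  · intro a h1 h2 h3
    simpa [h1, h2, h3] using hs.int_eq a h1 h2 h3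
  · simp
  · exact hs.real_eq
  · intro a h1 h2 h3
    simpa [h1, h2, h3] using hs.int_eq a h1 h2 h3
  · simpa using hs.result

/-- Item N + 1 replaces the current choice with probability 1/(N + 2), which reduces the share of
each earlier item from 1/(N + 1) to 1/(N + 2). The induction replaces `f` and `g` by their averages
over the last coin, so both have to be general. -/
theorem mean_reservoir_iterate_le (h1 : 1 % W = 1) (N : ℕ) {f : Mem → ℝ≥0∞} {g : ℕ → ℝ≥0∞}
    (h : ∀ j s', Sampled s j s' → f s' ≤ g j) (h9 : s.int 9 0 < n) (hN : N < n) :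
    mean (iterate (fun j s' => Prog.reservoir.run W (s'.setInt 8 0 j)) (N + 1) s)
      (fun o => f o.1) ≤
      ∑ j ∈ Finset.range (N + 1), ENNReal.ofReal (1 / ((N : ℝ) + 1)) * g j := by
  induction N generalizing f g with
  | zero =>
    rw [mean_iterate_succ]
    simp only [iterate, mean_pure]
    refine (mean_reservoir_le (g := g) (j := s.int 9 0) h1 ⟨rfl, fun _ _ _ _ => rfl, rfl⟩ h).trans ?_
    simp
  | succ N ih =>
    rw [mean_iterate_succ]
    have hpos : (0 : ℝ) < N + 1 := by positivity
    refine (mean_mono (g := fun o => ENNReal.ofReal (1 / ((N + 1 : ℕ) + 1)) * g (N + 1) +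
      ENNReal.ofReal ((N + 1 : ℕ) / ((N + 1 : ℕ) + 1)) * g (o.1.int 9 0)) ?_).trans
      ((ih (f := fun s' => ENNReal.ofReal (1 / ((N + 1 : ℕ) + 1)) * g (N + 1) +
      ENNReal.ofReal ((N + 1 : ℕ) / ((N + 1 : ℕ) + 1)) * g (s'.int 9 0))
      (g := fun j => ENNReal.ofReal (1 / ((N + 1 : ℕ) + 1)) * g (N + 1) +
      ENNReal.ofReal ((N + 1 : ℕ) / ((N + 1 : ℕ) + 1)) * g j) ?_ (by omega)).trans ?_)
    · intro o ho
      obtain ⟨j, -, hs⟩ := (ensures_iterate (s := s) (fun _ s' => ∃ j < n, Sampled s j s')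
        ⟨_, h9, rfl, fun _ _ _ _ => rfl, rfl⟩
        (fun j hj _ hs => ensures_reservoir (hj.trans_le hN.le) hs) o ho).1
      rw [hs.result]
      refine mean_reservoir_le h1 hs h
    · rintro j s' hs
      rw [hs.result]
    · rw [Finset.sum_range_succ _ (N + 1)]
      simp only [mul_add, Finset.sum_add_distrib, Finset.sum_const, Finset.card_range,
        ← mul_assoc, nsmul_eq_mul]
      rw [← ENNReal.ofReal_natCast (N + 1), ← ENNReal.ofReal_mul (by positivity),
        ← ENNReal.ofReal_mul (by positivity), add_comm]
      refine add_le_add (Finset.sum_le_sum fun j _ => ?_) ?_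
      · rw [← ENNReal.ofReal_mul (by positivity)]
        refine le_of_eq ?_
        congr 2
        push_cast
        field_simp
      · refine le_of_eq ?_
        congr 2
        push_cast
        field_simp

theorem mean_sample_le (h1 : 1 % W = 1) (hn : s.int 0 0 = n) (h9 : s.int 9 0 < n)
    {f : Mem → ℝ≥0∞} {g : Fin n → ℝ} (hg : ∀ j, 0 ≤ g j)
    (h : ∀ (j : Fin n) s', Sampled s j s' → f s' ≤ ENNReal.ofReal (g j)) :
    mean (Prog.sample.run W s) (fun o => f o.1) ≤ ENNReal.ofReal ((∑ j, g j) / n) := by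
  obtain ⟨N, rfl⟩ : ∃ N, n = N + 1 := ⟨n - 1, by omega⟩
  rw [Prog.sample, mean_loop]
  have := mean_reservoir_iterate_le (s := s) h1 N (f := f)
    -- The value ⊤ makes the hypothesis trivial at indices out of range; these do not occur in the
    -- sum.
    (g := fun j => if hj : j < N + 1 then ENNReal.ofReal (g ⟨j, hj⟩) else ⊤) ?_ h9 N.lt_succ_self
  · simp only [Prog.nE, Prog.iv, IExp.eval, Nat.zero_mod, hn]
    refine this.trans (le_of_eq ?_)
    rw [Finset.sum_range, ← Finset.mul_sum]
    simp only [Fin.is_lt, dite_true, Fin.eta]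
    rw [← ENNReal.ofReal_sum_of_nonneg fun j _ => hg j, ← ENNReal.ofReal_mul (by positivity)]
    congr 1
    push_cast
    ring
  · intro j s' hs
    split_ifs with hj
    · exact h ⟨j, hj⟩ s' hs
    · exact le_top

end sample

/-- The memory holds the input. -/
structure HoldsInput {m n : ℕ} (I : Input m n) (C : ℝ) (L : Columns I.A) (s : Mem) : Prop where
  n_eq : s.int 0 0 = n
  m_eq : s.int 0 1 = m
  ptr : s.int 1 = L.ptr
  row : s.int 2 = L.row
  C_eq : s.real 0 0 = C
  ρ₀_eq : s.real 0 1 = I.ρ₀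
  Λ_eq : s.real 0 2 = I.Λ
  val : s.real 1 = L.val
  ρp_eq : ∀ i : Fin m, s.real 2 i = I.ρp i
  ρm_eq : ∀ i : Fin m, s.real 3 i = I.ρm i
  v_eq : ∀ j : Fin n, s.real 4 j = I.v j

/-! ### The machine simulates one step -/

section move

variable {m n : ℕ} {I : Input m n} {C : ℝ} {L : Columns I.A} {s s' : Mem} {W : ℕ}

theorem holdsInput_mem : HoldsInput I C L (I.mem C L) := by
  constructor <;> simp [Input.mem, ofVec]

theorem HoldsInput.congr (h : HoldsInput I C L s) (hi : ∀ a ≤ 2, s'.int a = s.int a)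
    (hr : ∀ a ≤ 4, s'.real a = s.real a) : HoldsInput I C L s' := by
  constructor
  · rw [hi 0 (by norm_num), h.n_eq]
  · rw [hi 0 (by norm_num), h.m_eq]
  · rw [hi 1 (by norm_num), h.ptr]
  · rw [hi 2 (by norm_num), h.row]
  · rw [hr 0 (by norm_num), h.C_eq]
  · rw [hr 0 (by norm_num), h.ρ₀_eq]
  · rw [hr 0 (by norm_num), h.Λ_eq]
  · rw [hr 1 (by norm_num), h.val]
  · rw [hr 2 (by norm_num)]; exact h.ρp_eq
  · rw [hr 3 (by norm_num)]; exact h.ρm_eq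
  · rw [hr 4 (by norm_num)]; exact h.v_eq

theorem BigWords.succ_mod (hW : BigWords W n m) (j : Fin n) : ((j : ℕ) + 1) % W = j + 1 :=
  Nat.mod_eq_of_lt (by have := hW.row; have := j.2; omega)

theorem BigWords.ptr_mod (hW : BigWords W n m) (L : Columns I.A) (j : Fin n) {q : ℕ}
    (hq : q < L.len j) : (L.ptr j + q) % W = L.ptr j + q := by
  refine Nat.mod_eq_of_lt ?_
  have h1 := L.ptr_add_mem j hq
  have h2 := L.ptr_le_mul j.2
  have h3 : (j + 1) * m ≤ n * m := Nat.mul_le_mul_right m j.2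
  have := hW.row
  have := h1.2
  simp only [Nat.succ_eq_add_one] at h2
  omega

theorem eval_lenE (hW : BigWords W n m) (hs : HoldsInput I C L s) {j : Fin n}
    (h9 : s.int 9 0 = j) : Prog.lenE.eval W s = L.len j := by
  have h2 := L.ptr_le_mul j.2
  have h3 : (j + 1) * m ≤ n * m := Nat.mul_le_mul_right m j.2
  have := hW.row
  simp only [Nat.succ_eq_add_one] at h2
  simp [h9, hW.one_mod, hW.succ_mod, hs.ptr, Columns.len]
  exact Nat.mod_eq_of_lt (by omega)

/-- The effect of the loop that collects the objective and the constraints. -/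
structure Gathered (I : Input m n) (j : Fin n) (s s' : Mem) : Prop where
  int_eq : ∀ a, a ≠ 11 → a ≠ 12 → s'.int a = s.int a
  real_eq : ∀ a, a ≠ 12 → a ≠ 13 → s'.real a = s.real a
  obj : s'.real 12 0 = s.real 12 0 + ∑ i : Fin m, I.A i j * (s.real 2 i - s.real 3 i)
  con : s'.real 13 0 = s.real 13 0 + ∑ i : Fin m, I.A i j * (s.real 8 i - s.real 9 i)

theorem ensures_gather (hW : BigWords W n m) (hs : HoldsInput I C L s) {j : Fin n}
    (h9 : s.int 9 0 = j) :
    Ensures (Prog.gather.run W s) (Gathered I j s) (L.len j * 50 + 50) := by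
  refine (ensures_loop (t := 49) (fun q s' =>
    (∀ a, a ≠ 11 → a ≠ 12 → s'.int a = s.int a) ∧
    (∀ a, a ≠ 12 → a ≠ 13 → s'.real a = s.real a) ∧
    s'.real 12 0 = s.real 12 0 + ∑ q' ∈ Finset.range q, L.val (L.ptr j + q') *
      (s.real 2 (L.row (L.ptr j + q')) - s.real 3 (L.row (L.ptr j + q'))) ∧
    s'.real 13 0 = s.real 13 0 + ∑ q' ∈ Finset.range q, L.val (L.ptr j + q') *
      (s.real 8 (L.row (L.ptr j + q')) - s.real 9 (L.row (L.ptr j + q'))))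
    (L.len j) (eval_lenE hW hs h9) (by simp) ?_).weaken ?_ ?_
  · rintro q hq s₁ ⟨hi, hr, ho, hc⟩
    refine Ensures.weaken (Ensures.setInt_seq (Ensures.setReal_seq (ensures_setReal ?_)))
      (fun _ h => h) (by simp [IExp.cost, RExp.cost])
    have e1 := hs.ptr
    have e2 := hs.row
    have e3 := hs.val
    have e4 := hi 9 (by norm_num) (by norm_num)
    have e5 := hi 1 (by norm_num) (by norm_num)
    have e6 := hi 2 (by norm_num) (by norm_num)
    have hm := hW.ptr_mod L j hq
    refine ⟨?_, ?_, ?_, ?_⟩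
    · intro a h1 h2
      simpa [h1, h2] using hi a h1 h2
    · intro a h1 h2
      simpa [h1, h2] using hr a h1 h2
    · simp [e1, e2, e3, e4, e5, e6, h9, hm, hr, ho, Finset.sum_range_succ]
      ring
    · simp [e1, e2, e3, e4, e5, e6, h9, hm, hr, hc, Finset.sum_range_succ]
      ring
  · rintro s' ⟨hi, hr, ho, hc⟩
    refine ⟨hi, hr, ?_, ?_⟩
    · rw [ho, L.sum_eq j fun i => s.real 2 i - s.real 3 i]
    · rw [hc, L.sum_eq j fun i => s.real 8 i - s.real 9 i]
  · simp [IExp.cost]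

/-- The effect of the loop that updates the weights, for the step `y` and the step size `z` of the
weights. -/
structure Scattered (I : Input m n) (j : Fin n) (y z : ℝ) (s s' : Mem) : Prop where
  int_eq : ∀ a, a ≠ 11 → a ≠ 12 → s'.int a = s.int a
  real_eq : ∀ a, a ≠ 7 → a ≠ 8 → a ≠ 9 → s'.real a = s.real a
  prod : ∀ i : Fin m, s'.real 7 i = s.real 7 i + y * I.A i j
  up : ∀ i : Fin m, 1 + s'.real 8 i = (1 + s.real 8 i) * (1 + z * I.A i j)
  um : ∀ i : Fin m, 1 + s'.real 9 i = (1 + s.real 9 i) * (1 - z * I.A i j)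

/-- The invariant says that exactly the rows listed so far are updated. No row is listed twice, so
no factor is applied twice; rows never listed have a zero entry, for which the update is the
identity. -/
theorem ensures_scatter (hW : BigWords W n m) (hs : HoldsInput I C L s) {j : Fin n}
    (h9 : s.int 9 0 = j) :
    Ensures (Prog.scatter.run W s) (Scattered I j (s.real 14 0) (1 / √n * s.real 14 0) s)
      (L.len j * 100 + 50) := by
  classical
  refine (ensures_loop (t := 99) (fun q s' =>
    (∀ a, a ≠ 11 → a ≠ 12 → s'.int a = s.int a) ∧
    (∀ a, a ≠ 7 → a ≠ 8 → a ≠ 9 → s'.real a = s.real a) ∧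
    (∀ i : Fin m, s'.real 7 i = if ∃ q' < q, L.row (L.ptr j + q') = i then
      s.real 7 i + s.real 14 0 * I.A i j else s.real 7 i) ∧
    (∀ i : Fin m, s'.real 8 i = if ∃ q' < q, L.row (L.ptr j + q') = i then
      (1 + s.real 8 i) * (1 + 1 / √n * s.real 14 0 * I.A i j) - 1 else s.real 8 i) ∧
    (∀ i : Fin m, s'.real 9 i = if ∃ q' < q, L.row (L.ptr j + q') = i then
      (1 + s.real 9 i) * (1 - 1 / √n * s.real 14 0 * I.A i j) - 1 else s.real 9 i))
    (L.len j) (eval_lenE hW hs h9) (by simp) ?_).weaken ?_ ?_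
  · rintro q hq s₁ ⟨hi, hr, h7, h8, h9'⟩
    refine Ensures.weaken (Ensures.setInt_seq (Ensures.setReal_seq (Ensures.setReal_seq
      (ensures_setReal ?_)))) (fun _ h => h) (by simp [IExp.cost, RExp.cost])
    obtain ⟨i₀, hi₀, -, hv⟩ := L.exists_row j hq
    have e1 := hs.ptr
    have e2 := hs.row
    have e3 := hs.val
    have e4 := hi 9 (by norm_num) (by norm_num)
    have e5 := hi 1 (by norm_num) (by norm_num)
    have e6 := hi 2 (by norm_num) (by norm_num)
    have e7 := hi 0 (by norm_num) (by norm_num)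
    have e8 := hs.n_eq
    have e9 := hr 14 (by norm_num) (by norm_num) (by norm_num)
    have e10 := hr 1 (by norm_num) (by norm_num) (by norm_num)
    have hm := hW.ptr_mod L j hq
    have hnew : ¬ ∃ q' < q, L.row (L.ptr j + q') = i₀ := by
      rintro ⟨q', hq', h⟩
      have := L.row_inj j (hq'.trans hq) hq (h.trans hi₀.symm)
      omega
    have hcond : ∀ i : Fin m, (∃ q' < q + 1, L.row (L.ptr j + q') = i) ↔
        i = i₀ ∨ ∃ q' < q, L.row (L.ptr j + q') = i := by
      intro i
      constructor
      · rintro ⟨q', hq', h⟩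
        rcases Nat.lt_succ_iff_lt_or_eq.1 hq' with h' | rfl
        · exact Or.inr ⟨q', h', h⟩
        · exact Or.inl (Fin.ext (h.symm.trans hi₀))
      · rintro (rfl | ⟨q', hq', h⟩)
        · exact ⟨q, q.lt_succ_self, hi₀⟩
        · exact ⟨q', hq'.trans q.lt_succ_self, h⟩
    refine ⟨?_, ?_, ?_, ?_, ?_⟩
    · intro a h1 h2
      simpa [h1, h2] using hi a h1 h2
    · intro a h1 h2 h3
      simpa [h1, h2, h3] using hr a h1 h2 h3
    all_goals
      intro i
      rw [if_congr (hcond i) rfl rfl]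
      by_cases hii : i = i₀
      · subst hii
        simp only [true_or, if_true]
        simp [e1, e2, e3, e4, e5, e6, e7, e8, e9, e10, h9, hm, hi₀, hv, h7, h8, h9', hnew]
      · have hii' : (i : ℕ) ≠ i₀ := fun h => hii (Fin.ext h)
        simp only [hii, false_or]
        simp [e1, e2, e4, e5, e6, h9, hm, hi₀, hii', h7, h8, h9']
  · rintro s' ⟨hi, hr, h7, h8, h9'⟩
    refine ⟨hi, hr, ?_, ?_, ?_⟩
    all_goals
      intro i
      simp only [h7, h8, h9', L.exists_row_eq_iff j i]
      split_ifs with h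
      · try ring
      · have h0 : I.A i j = 0 := by simpa using h
        simp [h0]
  · simp [IExp.cost]

/-- The linear functional whose value at the output has to be small. -/
noncomputable def Input.obj (I : Input m n) (j : Fin n) : ℝ :=
  ∑ i, I.A i j * (I.ρp i - I.ρm i) - I.ρ₀ * I.v j / √n

/-- The step size of the weights. -/
noncomputable def rate (n : ℕ) : ℝ := 1 / √n

/-- The price of a violated constraint. -/
noncomputable def price (n : ℕ) : ℝ := 1 / (3 * Real.log n ^ 4)

/-- The state that the memory holds. -/
def read (m n : ℕ) (s : Mem) : State m n where
  X j := s.real 6 j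
  up i := 1 + s.real 8 i
  um i := 1 + s.real 9 i

/-- A step of the algorithm with the parameters of the program. -/
noncomputable def Input.step (I : Input m n) (σ : State m n) (j : Fin n) : State m n :=
  σ.step I.A I.obj (rate n) (price n) j

/-- The memory holds the input and a consistent state. -/
structure Consistent (I : Input m n) (C : ℝ) (L : Columns I.A) (s : Mem) : Prop where
  input : HoldsInput I C L s
  out : s.real 5 = 0
  prod : ∀ i : Fin m, s.real 7 i = (I.A *ᵥ (read m n s).X) i
  tot : 1 + s.real 10 0 = (read m n s).total
  objX : s.real 11 0 = I.obj ⬝ᵥ (read m n s).X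
  coord : s.int 9 0 < n

theorem Consistent.sampled (h : Consistent I C L s) {j : Fin n} (hs : Sampled s j s') :
    Consistent I C L s' ∧ read m n s' = read m n s := by
  have hr : read m n s' = read m n s := by simp [read, hs.real_eq]
  refine ⟨⟨h.input.congr (fun a ha => hs.int_eq a (by omega) (by omega) (by omega))
    (fun a _ => by rw [hs.real_eq]), ?_, ?_, ?_, ?_, ?_⟩, hr⟩
  · rw [hs.real_eq, h.out]
  · rw [hs.real_eq, hr]; exact h.prod
  · rw [hs.real_eq, hr]; exact h.tot
  · rw [hs.real_eq, hr]; exact h.objX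
  · rw [hs.result]; exact j.2

/-- The product with `A`, the total weight and the objective change by terms supported on one
column. Maintaining them incrementally makes the cost proportional to its length, up to an additive
constant. -/
theorem ensures_move (hW : BigWords W n m) (hs : Consistent I C L s) {j : Fin n}
    (h9 : s.int 9 0 = j) :
    Ensures (Prog.move.run W s)
      (fun s' => Consistent I C L s' ∧ read m n s' = I.step (read m n s) j)
      (L.len j * 150 + 300) := by
  have h1 := hW.one_mod
  have hin := hs.input
  set y := (read m n s).dir I.A I.obj (price n) j with hy
  set s₁ := (s.setReal 12 0 (0 - s.real 0 1 * s.real 4 j / √n)).setReal 13 0 0 with hs₁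
  have hs₁i : s₁.int = s.int := by simp [hs₁]
  have hs₁r : ∀ a, a ≠ 12 → a ≠ 13 → s₁.real a = s.real a := by
    intro a h1 h2
    simp [hs₁, h1, h2]
  have hin₁ : HoldsInput I C L s₁ :=
    hin.congr (fun a _ => by rw [hs₁i]) fun a ha => hs₁r a (by omega) (by omega)
  -- the state of the memory after the direction is chosen
  let R₂ : Mem → Prop := fun s₂ => (∀ a, a ≠ 11 → a ≠ 12 → s₂.int a = s.int a) ∧
    (∀ a, a ≠ 12 → a ≠ 13 → a ≠ 14 → s₂.real a = s.real a) ∧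
    s₂.real 12 0 = I.obj j ∧ s₂.real 13 0 = (read m n s).grad I.A j
  refine Ensures.weaken (u := L.len j * 150 + 300) (Ensures.setReal_seq (Ensures.setReal_seq
    (t := L.len j * 150 + 280) ?_)) (fun _ h => h) (by simp [IExp.cost, RExp.cost]; omega)
  have hstart : (s.setReal 12 (IExp.eval W s (.lit 0)) (RExp.eval W s (.sub (.lit 0)
      (.div (.mul (.get 0 (.lit 1)) (.get 4 (Prog.iv 9))) Prog.sqrtE)))).setReal 13
      (IExp.eval W (s.setReal 12 (IExp.eval W s (.lit 0)) (RExp.eval W s (.sub (.lit 0)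
      (.div (.mul (.get 0 (.lit 1)) (.get 4 (Prog.iv 9))) Prog.sqrtE)))) (.lit 0))
      (RExp.eval W (s.setReal 12 (IExp.eval W s (.lit 0)) (RExp.eval W s (.sub (.lit 0)
      (.div (.mul (.get 0 (.lit 1)) (.get 4 (Prog.iv 9))) Prog.sqrtE)))) (.lit 0)) = s₁ := by
    simp [hs₁, h1, h9, hin.n_eq]
  rw [hstart]
  refine Ensures.weaken (u := L.len j * 150 + 280) (Ensures.seq (t := L.len j * 50 + 50)
    (u := L.len j * 100 + 230) (R := R₂) ?_ ?_) (fun _ h => h) (by omega)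
  · refine (ensures_gather hW hin₁ (by rw [hs₁i, h9])).weaken ?_ le_rfl
    intro s₂ hg
    refine ⟨?_, ?_, ?_, ?_⟩
    · intro a h1 h2
      rw [hg.int_eq a h1 h2, hs₁i]
    · intro a h1 h2 _
      rw [hg.real_eq a h1 h2, hs₁r a h1 h2]
    · rw [hg.obj]
      have e1 : s₁.real 12 0 = 0 - I.ρ₀ * I.v j / √n := by
        simp [hs₁, hin.ρ₀_eq, hin.v_eq]
      simp only [hin₁.ρp_eq, hin₁.ρm_eq, e1, Input.obj]
      ring
    · rw [hg.con, hs₁r 8 (by norm_num) (by norm_num), hs₁r 9 (by norm_num) (by norm_num)]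
      have e1 : s₁.real 13 0 = 0 := by simp [hs₁]
      rw [e1, zero_add]
      simp only [State.grad, read]
      exact Finset.sum_congr rfl fun i _ => by ring
  rintro s₂ ⟨hi₂, hr₂, ho₂, hc₂⟩
  have htot₂ : s₂.real 10 = s.real 10 := hr₂ 10 (by norm_num) (by norm_num) (by norm_num)
  have hn₂ : s₂.int 0 0 = n := by rw [hi₂ 0 (by norm_num) (by norm_num), hin.n_eq]
  let R₃ : Mem → Prop := fun s₃ => (∀ a, a ≠ 11 → a ≠ 12 → s₃.int a = s.int a) ∧
    (∀ a, a ≠ 12 → a ≠ 13 → a ≠ 14 → s₃.real a = s.real a) ∧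
    s₃.real 12 0 = I.obj j ∧ s₃.real 13 0 = (read m n s).grad I.A j ∧ s₃.real 14 0 = y
  refine Ensures.weaken (u := L.len j * 100 + 230) (Ensures.seq (t := 80)
    (u := L.len j * 100 + 150) (R := R₃) ?_ ?_) (fun _ h => h) (by omega)
  · have hcond : BExp.eval W s₂ (.rle (.add (Prog.rv 12) (.mul Prog.priceE
        (.div (Prog.rv 13) (.add (.lit 1) (Prog.rv 10))))) (.lit 0)) ↔
        I.obj j + price n * ((read m n s).grad I.A j / (read m n s).total) ≤ 0 := by
      rw [← hs.tot, ← htot₂, ← ho₂, ← hc₂]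
      have : price n = 1 / (3 * (Real.log n * (Real.log n * (Real.log n * Real.log n)))) := by
        unfold price; ring
      rw [this]
      simp [hn₂]
    refine (ensures_ite (t := 6) ?_ ?_).weaken (fun _ h => h) (by simp [BExp.cost, RExp.cost, IExp.cost])
    · intro h
      rw [hcond] at h
      refine (ensures_setReal ?_).weaken (fun _ h => h) (by simp [RExp.cost, IExp.cost])
      refine ⟨?_, ?_, ?_, ?_, ?_⟩
      · simpa using hi₂
      · intro a h1 h2 h3
        simpa [h3] using hr₂ a h1 h2 h3
      · simpa using ho₂
      · simpa using hc₂
      · simp [hy, State.dir, h]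
    · intro h
      rw [hcond] at h
      refine (ensures_setReal ?_).weaken (fun _ h => h) (by simp [RExp.cost, IExp.cost])
      refine ⟨?_, ?_, ?_, ?_, ?_⟩
      · simpa using hi₂
      · intro a h1 h2 h3
        simpa [h3] using hr₂ a h1 h2 h3
      · simpa using ho₂
      · simpa using hc₂
      · simp [hy, State.dir, h]
  rintro s₃ ⟨hi₃, hr₃, ho₃, hc₃, hy₃⟩
  have hin₃ : HoldsInput I C L s₃ := hin.congr (fun a ha => hi₃ a (by omega) (by omega))
    fun a ha => hr₃ a (by omega) (by omega) (by omega)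
  have h9₃ : s₃.int 9 0 = j := by rw [hi₃ 9 (by norm_num) (by norm_num), h9]
  refine Ensures.weaken (Ensures.seq (u := 100) (ensures_scatter hW hin₃ h9₃) ?_) (fun _ h => h)
    (by omega)
  intro s₄ hsc
  refine Ensures.weaken (Ensures.setReal_seq (Ensures.setReal_seq (ensures_setReal ?_)))
    (fun _ h => h) (by simp [IExp.cost, RExp.cost])
  have hr₄ : ∀ a, a ≠ 7 → a ≠ 8 → a ≠ 9 → a ≠ 12 → a ≠ 13 → a ≠ 14 → s₄.real a = s.real a := by
    intro a h1 h2 h3 h4 h5 h6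
    rw [hsc.real_eq a h1 h2 h3, hr₃ a h4 h5 h6]
  have hi₄ : ∀ a, a ≠ 11 → a ≠ 12 → s₄.int a = s.int a := by
    intro a h1 h2
    rw [hsc.int_eq a h1 h2, hi₃ a h1 h2]
  have hn₄ : s₄.int 0 0 = n := by rw [hi₄ 0 (by norm_num) (by norm_num), hin.n_eq]
  have h9₄ : s₄.int 9 0 = j := by rw [hi₄ 9 (by norm_num) (by norm_num), h9]
  have hy₄ : s₄.real 14 0 = y := by
    rw [hsc.real_eq 14 (by norm_num) (by norm_num) (by norm_num), hy₃]
  have ho₄ : s₄.real 12 0 = I.obj j := by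
    rw [hsc.real_eq 12 (by norm_num) (by norm_num) (by norm_num), ho₃]
  have hc₄ : s₄.real 13 0 = (read m n s).grad I.A j := by
    rw [hsc.real_eq 13 (by norm_num) (by norm_num) (by norm_num), hc₃]
  have h6₄ : s₄.real 6 = s.real 6 := by apply hr₄ <;> norm_num
  have h10₄ : s₄.real 10 = s.real 10 := by apply hr₄ <;> norm_num
  have h11₄ : s₄.real 11 = s.real 11 := by apply hr₄ <;> norm_num
  have h7₄ : ∀ i : Fin m, s₄.real 7 i = s.real 7 i + y * I.A i j := by
    intro i
    rw [hsc.prod, hy₃, hr₃ 7 (by norm_num) (by norm_num) (by norm_num)]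
  have h8₄ : ∀ i : Fin m, 1 + s₄.real 8 i = (1 + s.real 8 i) * (1 + rate n * y * I.A i j) := by
    intro i
    rw [hsc.up, hy₃, hr₃ 8 (by norm_num) (by norm_num) (by norm_num), rate]
  have h9₄' : ∀ i : Fin m, 1 + s₄.real 9 i = (1 + s.real 9 i) * (1 - rate n * y * I.A i j) := by
    intro i
    rw [hsc.um, hy₃, hr₃ 9 (by norm_num) (by norm_num) (by norm_num), rate]
  generalize hs₅ : Mem.setReal (Mem.setReal (Mem.setReal s₄ 6 _ _) 11 _ _) 10 _ _ = s₅
  have hread : read m n s₅ = I.step (read m n s) j := by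
    rw [← hs₅]
    ext l
    · by_cases hl : l = j
      · subst hl
        simp [read, Input.step, State.step, h9₄, hy₄, h6₄, hy]
      · have hl' : (l : ℕ) ≠ j := fun h => hl (Fin.ext h)
        simp [read, Input.step, State.step, h9₄, h6₄, hl, hl']
    · simp [read, Input.step, State.step, h8₄, hy]
    · simp [read, Input.step, State.step, h9₄', hy]
  refine ⟨⟨?_, ?_, ?_, ?_, ?_, ?_⟩, hread⟩
  · refine hin.congr (fun a ha => ?_) fun a ha => ?_
    · rw [← hs₅]
      simpa using hi₄ a (by omega) (by omega)
    · rw [← hs₅]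
      have := hr₄ a (by omega) (by omega) (by omega) (by omega) (by omega) (by omega)
      simpa [show a ≠ 6 by omega, show a ≠ 10 by omega, show a ≠ 11 by omega] using this
  · rw [← hs₅]
    have : s₄.real 5 = s.real 5 := by apply hr₄ <;> norm_num
    simpa [hs.out] using this
  · intro i
    rw [hread, Input.step, State.mulVec_step, ← hs.prod, ← hs₅]
    simp [h7₄, hy]
  · rw [hread, Input.step, State.total_step, ← hs.tot, ← hs₅]
    simp [h10₄, hc₄, hy₄, hn₄, hy, rate]
    ring
  · rw [hread, Input.step, State.dotProduct_step, ← hs.objX, ← hs₅]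
    simp [h11₄, ho₄, hy₄, hy]
  · rw [← hs₅]
    simp [h9₄]

end move

section phases

variable {m n k : ℕ} {I : Input m n} {C : ℝ} {L : Columns I.A} {s s' : Mem} {W : ℕ}

/-! ### Initialization -/

/-- The initial state. -/
def State.init (m n : ℕ) : State m n where
  X _ := 0
  up _ := 1
  um _ := 1

/-- The memory after the initialization. -/
structure Prepared (I : Input m n) (C : ℝ) (L : Columns I.A) (s : Mem) : Prop where
  consistent : Consistent I C L s
  read_eq : read m n s = State.init m n
  le_pow : n ≤ 2 ^ s.int 4 0
  pow_le : 2 ^ s.int 4 0 ≤ 2 * n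

/-- Without early exit, the invariant is that the power of two has reached n or the exponent equals
the number of passes. Since n < 2ⁿ, n passes suffice; doubling only below n keeps the power at most
2n. -/
theorem ensures_prepare (hW : BigWords W n m) (hn : 0 < n) :
    Ensures (Prog.prepare.run W (I.mem C L)) (Prepared I C L) (n * 30 + 30) := by
  have h1 := hW.one_mod
  refine Ensures.weaken (u := n * 30 + 30) (Ensures.setInt_seq (t := n * 30 + 20)
    (Ensures.weaken (u := n * 30 + 20) (Ensures.seq (t := n * 30 + 5) (u := 10)
    (R := fun s' => (∀ a, a ≠ 4 → a ≠ 5 → a ≠ 6 → s'.int a = (I.mem C L).int a) ∧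
      s'.real = (I.mem C L).real ∧ n ≤ 2 ^ s'.int 4 0 ∧ 2 ^ s'.int 4 0 ≤ 2 * n)
    ?_ ?_) (fun _ h => h) (by omega))) (fun _ h => h) (by simp [IExp.cost]; omega)
  · refine (ensures_loop (t := 29) (fun q s' =>
      (∀ a, a ≠ 4 → a ≠ 5 → a ≠ 6 → s'.int a = (I.mem C L).int a) ∧
      s'.real = (I.mem C L).real ∧ s'.int 5 0 = 2 ^ s'.int 4 0 ∧ 2 ^ s'.int 4 0 ≤ 2 * n ∧
      (n ≤ 2 ^ s'.int 4 0 ∨ s'.int 4 0 = q)) n ?_ ?_ ?_).weaken ?_ ?_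
    · simp [Input.mem]
    · refine ⟨?_, ?_, ?_, ?_, ?_⟩
      · intro a _ h _
        simp [h]
      · simp
      · simp [Input.mem, h1]
      · simp [Input.mem]; omega
      · simp [Input.mem]
    · rintro q hq s₁ ⟨hi, hr, h5, h4, hq4⟩
      have hn₁ : s₁.int 0 0 = n := by
        rw [hi 0 (by norm_num) (by norm_num) (by norm_num)]; simp [Input.mem]
      refine (ensures_ite (t := 20) ?_ ?_).weaken (fun _ h => h) (by simp [BExp.cost, IExp.cost])
      · intro hc
        refine (ensures_skip ?_).weaken (fun _ h => h) (by norm_num)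
        simp [hn₁, h5] at hc
        refine ⟨?_, ?_, ?_, ?_, ?_⟩
        · intro a ha hb hd
          simpa [hd] using hi a ha hb hd
        · simpa using hr
        · simpa using h5
        · simpa using h4
        · simpa using Or.inl hc
      · intro hc
        simp [hn₁, h5] at hc
        have hq4' : s₁.int 4 0 = q := hq4.resolve_left (by omega)
        have hm1 : (2 ^ s₁.int 4 0 + 2 ^ s₁.int 4 0) % W = 2 ^ (s₁.int 4 0 + 1) := by
          rw [pow_succ, mul_two]
          exact Nat.mod_eq_of_lt (by have := hW.dbl; omega)
        have hm2 : (s₁.int 4 0 + 1) % W = s₁.int 4 0 + 1 :=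
          Nat.mod_eq_of_lt (by have := hW.dbl; omega)
        refine (Ensures.setInt_seq (ensures_setInt ?_)).weaken (fun _ h => h) (by simp [IExp.cost])
        refine ⟨?_, ?_, ?_, ?_, ?_⟩
        · intro a ha hb hd
          simpa [ha, hb, hd] using hi a ha hb hd
        · simpa using hr
        · simp [h5, hm1, hm2, h1]
        · simp [hm2, h1, pow_succ]
          omega
        · right
          rw [hq4'] at hm2
          simp [hm2, h1, hq4']
    · rintro s' ⟨hi, hr, h5, h4, hq4⟩
      refine ⟨hi, hr, ?_, h4⟩
      rcases hq4 with h | h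
      · exact h
      · rw [h]; exact Nat.lt_two_pow_self.le
    · simp [IExp.cost]
  · rintro s₁ ⟨hi, hr, h4, h4'⟩
    refine (ensures_setReal ?_).weaken (fun _ h => h) (by simp [IExp.cost, RExp.cost])
    have hm₁ : s₁.int 0 1 = m := by
      rw [hi 0 (by norm_num) (by norm_num) (by norm_num)]; simp [Input.mem]
    have hin : HoldsInput I C L s₁ := holdsInput_mem.congr
      (fun a ha => hi a (by omega) (by omega) (by omega)) fun a _ => by rw [hr]
    generalize hs₂ : Mem.setReal s₁ 10 _ _ = s₂
    have hread : read m n s₂ = State.init m n := by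
      rw [← hs₂]
      ext <;> simp [read, State.init, hr, Input.mem]
    refine ⟨⟨?_, ?_, ?_, ?_, ?_, ?_⟩, hread, ?_, ?_⟩
    · refine hin.congr (fun a _ => ?_) fun a ha => ?_
      · rw [← hs₂]; simp
      · rw [← hs₂]; simp [show a ≠ 10 by omega]
    · rw [← hs₂]; simp [hr, Input.mem]
    · intro i
      rw [hread, ← hs₂]
      simp [hr, Input.mem, State.init, Matrix.mulVec, dotProduct]
    · rw [hread, ← hs₂]
      simp [State.init, State.total, h1, hm₁, add_assoc]
    · rw [hread, ← hs₂]
      simp [hr, Input.mem, State.init, dotProduct]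
    · rw [← hs₂]
      simpa [hi 9, Input.mem] using hn
    · rw [← hs₂]; simpa using h4
    · rw [← hs₂]; simpa using h4'

/-! ### The main loop -/

theorem Consistent.setInt (h : Consistent I C L s) {a : ℕ} (ha : 2 < a) (ha9 : a ≠ 9) (i x : ℕ) :
    Consistent I C L (s.setInt a i x) := by
  refine ⟨h.input.congr (fun b hb => ?_) (fun b _ => rfl), h.out, h.prod, h.tot, h.objX, ?_⟩
  · simp [show b ≠ a by omega]
  · simpa [ha9.symm] using h.coord

theorem ensures_step (hW : BigWords W n m) (hk : ∀ j : Fin n, L.len j ≤ k)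
    (hs : Consistent I C L s) :
    Ensures ((Cmd.seq Prog.sample Prog.move).run W s)
      (fun s' => Consistent I C L s' ∧ ∃ j, read m n s' = I.step (read m n s) j)
      (n * 20 + k * 150 + 303) := by
  refine (Ensures.seq (ensures_sample hs.input.n_eq hs.coord)
    (u := k * 150 + 300) ?_).weaken (fun _ h => h) (by omega)
  rintro s₁ ⟨j, hj, h₁⟩
  obtain ⟨hc, hr⟩ := hs.sampled (j := ⟨j, hj⟩) h₁
  have hkj := hk ⟨j, hj⟩
  refine (ensures_move hW hc (j := ⟨j, hj⟩) h₁.result).weaken ?_ (by omega)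
  rintro s₂ ⟨h₂, hr₂⟩
  exact ⟨h₂, ⟨j, hj⟩, by rw [hr₂, hr]⟩

/-- Given the sampled coordinate the rest of the step is deterministic, so the mean is an average
over coordinates. -/
theorem mean_step_le (hW : BigWords W n m) (hs : Consistent I C L s) {F : State m n → ℝ}
    (hF : ∀ σ, 0 ≤ F σ) :
    mean ((Cmd.seq Prog.sample Prog.move).run W s) (fun o => ENNReal.ofReal (F (read m n o.1))) ≤
      ENNReal.ofReal ((∑ j, F (I.step (read m n s) j)) / n) := by
  rw [mean_seq _ _ fun s => ENNReal.ofReal (F (read m n s))]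
  refine mean_sample_le hW.one_mod hs.input.n_eq hs.coord
    (f := fun s' => mean (Prog.move.run W s') fun o => ENNReal.ofReal (F (read m n o.1)))
    (fun j => hF _) fun j s₁ h₁ => mean_le fun o ho => ?_
  obtain ⟨hc, hr⟩ := hs.sampled h₁
  rw [(ensures_move hW hc h₁.result o ho).1.2, hr]

theorem eval_iterE (hW : BigWords W n m) (hn : s.int 0 0 = n) (h4 : s.int 4 0 ≤ 2 * n) :
    Prog.iterE.eval W s = n * (1000 * s.int 4 0 ^ 7) := by
  have h := hW.iter _ h4
  simp only [Prog.iterE, Prog.iv, Prog.nE, IExp.eval, Nat.mul_mod_mod, Nat.mod_mul_mod,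
    Nat.zero_mod, hn]
  rw [Nat.mod_eq_of_lt]
  · ring
  · calc _ = n * (1000 * s.int 4 0 ^ 7) := by ring
      _ < W := h

/-- What holds after `t` steps of the main loop. -/
def Reached (I : Input m n) (C : ℝ) (L : Columns I.A) (t : ℕ) (s : Mem) : Prop :=
  Consistent I C L s ∧ (read m n s).Bounded I.A (rate n) t

theorem Prepared.reached (h : Prepared I C L s) : Reached I C L 0 s := by
  refine ⟨h.consistent, ?_⟩
  rw [h.read_eq]
  intro i
  have : (I.A *ᵥ fun _ => (0 : ℝ)) i = 0 := by simp [Matrix.mulVec, dotProduct]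
  simp [State.init, this]

theorem rate_pos (hn : 4 ≤ n) : 0 < rate n := by
  unfold rate
  have : (0 : ℝ) < n := by exact_mod_cast (by omega)
  positivity

theorem rate_le (hn : 4 ≤ n) : rate n ≤ 1 / 2 := by
  unfold rate
  have h : (2 : ℝ) ≤ √n := by
    apply Real.le_sqrt_of_sq_le
    norm_num
    exact_mod_cast hn
  exact one_div_le_one_div_of_le (by norm_num) h

theorem ensures_reached (hW : BigWords W n m) (hn : 4 ≤ n) (hA : ∀ i j, |I.A i j| ≤ 1)
    (hk : ∀ j : Fin n, L.len j ≤ k) {t : ℕ} (hs : Reached I C L t s) :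
    Ensures ((Cmd.seq Prog.sample Prog.move).run W (s.setInt 7 0 t)) (Reached I C L (t + 1))
      (n * 20 + k * 150 + 303) := by
  refine (ensures_step hW hk (hs.1.setInt (by norm_num) (by norm_num) 0 t)).weaken ?_ le_rfl
  rintro s' ⟨hc, j, hj⟩
  refine ⟨hc, ?_⟩
  rw [hj]
  exact State.Bounded.step hs.2 hA (rate_pos hn).le (rate_le hn) j

theorem ensures_mainLoop (hW : BigWords W n m) (hn : 4 ≤ n) (hA : ∀ i j, |I.A i j| ≤ 1)
    (hk : ∀ j : Fin n, L.len j ≤ k) (hs : Prepared I C L s) :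
    Ensures (Prog.mainLoop.run W s) (Reached I C L (n * (1000 * s.int 4 0 ^ 7)))
      (n * (1000 * s.int 4 0 ^ 7) * (n * 20 + k * 150 + 304) + 50) :=
  (ensures_loop (Reached I C L) _
    (eval_iterE hW hs.consistent.input.n_eq (Nat.lt_two_pow_self.le.trans hs.pow_le)) hs.reached
    fun _ _ _ h => ensures_reached hW hn hA hk h).weaken (fun _ h => h)
    (by simp [IExp.cost, Prog.iterE])

theorem mean_mainLoop_le (hW : BigWords W n m) (hn : 4 ≤ n) (hA : ∀ i j, |I.A i j| ≤ 1)
    (hs : Prepared I C L s) {F : State m n → ℝ} (hF : ∀ σ, 0 ≤ F σ) {c : ℝ}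
    (hstep : ∀ σ t, σ.Bounded I.A (rate n) t →
      (∑ j, F (I.step σ j)) / n ≤ Real.exp c * F σ) :
    mean (Prog.mainLoop.run W s) (fun o => ENNReal.ofReal (F (read m n o.1))) ≤
      ENNReal.ofReal (Real.exp ((n * (1000 * s.int 4 0 ^ 7) : ℕ) * c) * F (State.init m n)) := by
  -- Any bound on the column lengths will do: the running time plays no role in this mean.
  obtain ⟨k, hk⟩ : ∃ k, ∀ j : Fin n, L.len j ≤ k :=
    ⟨∑ j : Fin n, L.len j, fun j =>
      Finset.single_le_sum (f := fun j : Fin n => L.len j) (fun _ _ => Nat.zero_le _)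
        (Finset.mem_univ j)⟩
  rw [Prog.mainLoop, mean_loop _ _ _ fun s => ENNReal.ofReal (F (read m n s)),
    eval_iterE hW hs.consistent.input.n_eq (Nat.lt_two_pow_self.le.trans hs.pow_le)]
  refine (mean_iterate_le (Reached I C L) (fun s => ENNReal.ofReal (F (read m n s)))
    (ENNReal.ofReal (Real.exp c)) hs.reached
    (fun _ _ _ h => ensures_reached hW hn hA hk h) ?_).trans ?_
  · intro t _ s₁ h₁
    refine (mean_step_le hW (h₁.1.setInt (by norm_num) (by norm_num) 0 t) hF).trans ?_
    rw [← ENNReal.ofReal_mul (Real.exp_pos _).le]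
    exact ENNReal.ofReal_le_ofReal (hstep _ t h₁.2)
  · rw [← ENNReal.ofReal_pow (Real.exp_pos _).le, ← ENNReal.ofReal_mul (by positivity),
      ← Real.exp_nat_mul, hs.read_eq]

/-! ### The output -/

/-- The flag in `int 3 [0]` tells whether `P` holds. -/
def Flag (P : Prop) (s : Mem) : Prop := s.int 3 0 = 1 ∧ P ∨ s.int 3 0 = 0 ∧ ¬ P

theorem ensures_check {P : Prop} (hs : Flag P s) (e f : RExp) :
    Ensures ((Prog.check e f).run W s) (fun s' => s'.real = s.real ∧
      (∀ a, a ≠ 3 → s'.int a = s.int a) ∧ Flag (P ∧ |e.eval W s| ≤ f.eval W s) s')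
      (2 * e.cost + 2 * f.cost + 20) := by
  refine (ensures_ite (t := 3) ?_ ?_).weaken (fun _ h => h)
    (by simp [BExp.cost, RExp.cost]; omega)
  · intro hc
    refine (ensures_skip ?_).weaken (fun _ h => h) (by norm_num)
    refine ⟨rfl, fun _ _ => rfl, ?_⟩
    have : |e.eval W s| ≤ f.eval W s := by
      simp at hc
      rw [abs_le]; exact ⟨by linarith, hc.1⟩
    simpa [Flag, this] using hs
  · intro hc
    refine (ensures_setInt ?_).weaken (fun _ h => h) (by simp [IExp.cost])
    refine ⟨rfl, fun a ha => by simp [ha], Or.inr ⟨by simp, fun h => hc ?_⟩⟩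
    have := abs_le.1 h.2
    simp
    exact ⟨this.2, by linarith⟩

/-- The bound on the objective at the output. -/
noncomputable def Input.target (I : Input m n) (C : ℝ) : ℝ :=
  -(I.ρ₀ * I.Λ) + discBound C m n * (1 - I.ρ₀) + √n / Real.log n ^ 3

/-- The bound on the width of the output. -/
noncomputable def width (n : ℕ) : ℝ := 10 * √n * Real.log n ^ 4

theorem obj_dotProduct (x : Fin n → ℝ) : I.obj ⬝ᵥ x =
    -I.ρ₀ * (I.v ⬝ᵥ x) / √n + I.ρp ⬝ᵥ (I.A *ᵥ x) - I.ρm ⬝ᵥ (I.A *ᵥ x) := by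
  have e1 : I.obj = (I.ρp - I.ρm) ᵥ* I.A - (I.ρ₀ / √n) • I.v := by
    ext j
    simp only [Input.obj, Matrix.vecMul, dotProduct, Pi.sub_apply, Pi.smul_apply, smul_eq_mul]
    congr 1
    · exact Finset.sum_congr rfl fun i _ => mul_comm _ _
    · ring
  rw [e1, sub_dotProduct, ← Matrix.dotProduct_mulVec, sub_dotProduct, smul_dotProduct,
    smul_eq_mul]
  ring

theorem Input.Valid.sum_eq' (hI : I.Valid k) : ∑ i, |I.ρp i| + ∑ i, |I.ρm i| = 1 - I.ρ₀ := by
  have := hI.sum_eq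
  linarith

theorem Input.Valid.isGood (hI : I.Valid k) {x : Fin n → ℝ} (hx : ∀ j, |x j| ≤ 1)
    (hw : ∀ i, |(I.A *ᵥ x) i| ≤ width n) (ho : I.obj ⬝ᵥ x ≤ I.target C) : I.IsGood C x := by
  refine ⟨fun j => _root_.abs_le.1 (hx j), ?_, ?_⟩
  · rw [pi_norm_le_iff_of_nonneg]
    · exact hw
    · have := Real.log_natCast_nonneg n
      positivity
  · rw [hI.sum_eq', ← obj_dotProduct]
    calc _ ≤ I.target C := ho
      _ = _ := by unfold Input.target; ring

/-- The conditions under which a state leads to an output. -/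
def Input.Passes (I : Input m n) (C : ℝ) (σ : State m n) : Prop :=
  0 ≤ I.target C ∨ I.obj ⬝ᵥ σ.X < 0 ∧
    (∀ j, |σ.X j * (I.target C / I.obj ⬝ᵥ σ.X)| ≤ 1) ∧
    ∀ i, |(I.A *ᵥ σ.X) i * (I.target C / I.obj ⬝ᵥ σ.X)| ≤ width n

theorem Input.Valid.isGood_smul (hI : I.Valid k) {X : Fin n → ℝ} {c : ℝ}
    (hx : ∀ j, |X j * c| ≤ 1) (hw : ∀ i, |(I.A *ᵥ X) i * c| ≤ width n)
    (ho : I.obj ⬝ᵥ X * c ≤ I.target C) : I.IsGood C fun j => X j * c := by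
  have e : (fun j => X j * c) = c • X := by ext j; simp [mul_comm]
  refine hI.isGood hx (fun i => ?_) ?_
  · rw [e, Matrix.mulVec_smul, Pi.smul_apply, smul_eq_mul, mul_comm]
    exact hw i
  · rwa [e, dotProduct_smul, smul_eq_mul, mul_comm]

/-- Holds for every outcome: an accepted point has been verified, and a rejection means that the
state does not pass. All randomness is thereby reduced to the state reached by the main loop. -/
theorem ensures_finish (hW : BigWords W n m) (hI : I.Valid k) (hs : Consistent I C L s) :
    Ensures (Prog.finish.run W s) (fun s' =>
      s'.int 3 0 = 1 ∧ I.IsGood C (toVec n (s'.real 5)) ∨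
      s'.int 3 0 = 0 ∧ ¬ I.Passes C (read m n s)) (n * 100 + m * 100 + 400) := by
  have h1 := hW.one_mod
  have hin := hs.input
  have h2 : 2 % W = 2 := Nat.mod_eq_of_lt (by have := hW.dbl; have := hs.coord; omega)
  have hτ : (Prog.targetE.eval W (s.setInt 3 0 1)) = I.target C := by
    simp [Prog.targetE, Input.target, discBound, hin.n_eq, hin.m_eq, hin.ρ₀_eq, hin.Λ_eq, hin.C_eq,
      h1, h2]
    ring
  set σ := read m n s with hσ
  have hobj := hs.objX
  rw [← hσ] at hobj
  have hw0 : 0 ≤ width n := by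
    have := Real.log_natCast_nonneg n
    unfold width
    positivity
  set s₁ := (s.setInt 3 0 1).setReal 15 0 (I.target C) with hs₁
  refine Ensures.weaken (u := n * 100 + m * 100 + 400) (Ensures.setInt_seq (Ensures.setReal_seq
    (t := n * 100 + m * 100 + 330) ?_)) (fun _ h => h)
    (by simp [Prog.targetE, RExp.cost, IExp.cost]; omega)
  have hstart : ((s.setInt 3 (IExp.eval W s (.lit 0)) (IExp.eval W s (.lit 1))).setReal 15
      (IExp.eval W (s.setInt 3 (IExp.eval W s (.lit 0)) (IExp.eval W s (.lit 1))) (.lit 0))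
      (RExp.eval W (s.setInt 3 (IExp.eval W s (.lit 0)) (IExp.eval W s (.lit 1)))
        Prog.targetE)) = s₁ := by
    simp only [IExp.eval, Nat.zero_mod, h1, hτ, hs₁]
  rw [hstart]
  refine (ensures_ite (t := n * 100 + m * 100 + 300) ?_ ?_).weaken (fun _ h => h)
    (by simp [BExp.cost, RExp.cost, IExp.cost])
  · intro hc
    have hc' : 0 ≤ I.target C := by simpa [hs₁] using hc
    refine (ensures_skip (Or.inl ⟨by simp [hs₁], ?_⟩)).weaken (fun _ h => h) (by omega)
    have : toVec n (s₁.real 5) = fun j => (0 : Fin n → ℝ) j * 0 := by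
      ext j
      simp [toVec, hs₁, hs.out]
    rw [this]
    exact hI.isGood_smul (by simp) (by simp [hw0]) (by simpa using hc')
  intro hc
  have hc' : I.target C < 0 := by simpa [hs₁] using hc
  refine (ensures_ite (t := n * 100 + m * 100 + 260) ?_ ?_).weaken (fun _ h => h)
    (by simp [BExp.cost, RExp.cost, IExp.cost])
  · intro ho
    have ho' : 0 ≤ I.obj ⬝ᵥ σ.X := by simpa [hs₁, hobj] using ho
    refine (ensures_setInt (Or.inr ⟨by simp, ?_⟩)).weaken (fun _ h => h)
      (by simp [IExp.cost])
    rintro (h | ⟨h, -⟩) <;> linarith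
  intro ho
  have ho' : I.obj ⬝ᵥ σ.X < 0 := by simpa [hs₁, hobj] using ho
  set c := I.target C / I.obj ⬝ᵥ σ.X with hcdef
  refine Ensures.weaken (Ensures.setReal_seq (t := n * 100 + m * 100 + 210) ?_) (fun _ h => h)
    (by simp [RExp.cost, IExp.cost]; omega)
  generalize hs₂ : Mem.setReal s₁ 16 _ _ = s₂
  have h16 : s₂.real 16 0 = c := by
    rw [← hs₂]
    simp [hs₁, hobj, hcdef]
  have hr₂ : ∀ a, a ≠ 15 → a ≠ 16 → s₂.real a = s.real a := by
    intro a h1 h2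
    rw [← hs₂]
    simp [hs₁, h1, h2]
  have hi₂ : ∀ a, a ≠ 3 → s₂.int a = s.int a := by
    intro a h1
    rw [← hs₂]
    simp [hs₁, h1]
  have h3₂ : s₂.int 3 0 = 1 := by
    rw [← hs₂]
    simp [hs₁]
  have hn₂ : s₂.int 0 0 = n := by rw [hi₂ 0 (by norm_num), hin.n_eq]
  refine (Ensures.seq (t := n * 100 + 10) (u := m * 100 + 50) (R := fun s' =>
    (∀ a, a ≠ 3 → a ≠ 13 → s'.int a = s₂.int a) ∧ (∀ a, a ≠ 5 → s'.real a = s₂.real a) ∧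
    (∀ l < n, s'.real 5 l = s.real 6 l * c) ∧ Flag (∀ l < n, |s.real 6 l * c| ≤ 1) s')
    ?_ ?_).weaken (fun _ h => h) (by omega)
  · refine (ensures_loop (t := 98) (fun q s' =>
      (∀ a, a ≠ 3 → a ≠ 13 → s'.int a = s₂.int a) ∧ (∀ a, a ≠ 5 → s'.real a = s₂.real a) ∧
      (∀ l < q, s'.real 5 l = s.real 6 l * c) ∧ Flag (∀ l < q, |s.real 6 l * c| ≤ 1) s') n
      (by simp [hn₂]) ⟨fun _ _ _ => rfl, fun _ _ => rfl, by simp, Or.inl ⟨h3₂, by simp⟩⟩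
      ?_).weaken (fun _ h => h) (by simp [IExp.cost]; omega)
    rintro q hq s₃ ⟨hi, hr, h5, hf⟩
    refine Ensures.weaken (Ensures.setReal_seq (ensures_check
      (P := ∀ l < q, |s.real 6 l * c| ≤ 1) (by simpa [Flag] using hf) _ _)) ?_
      (by simp [RExp.cost, IExp.cost])
    rintro s₄ ⟨hr₄, hi₄, hf₄⟩
    refine ⟨?_, ?_, ?_, ?_⟩
    · intro a ha hb
      rw [hi₄ a ha]
      simpa [hb] using hi a ha hb
    · intro a ha
      rw [hr₄]
      simpa [ha] using hr a ha
    · intro l hl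
      rw [hr₄]
      rcases Nat.lt_succ_iff_lt_or_eq.1 hl with hl | rfl
      · simpa [hl.ne] using h5 l hl
      · simp [hr 6, hr 16, h16, hr₂ 6]
    · have e : (∀ l < q + 1, |s.real 6 l * c| ≤ 1) ↔
          (∀ l < q, |s.real 6 l * c| ≤ 1) ∧ |s.real 6 q * c| ≤ 1 :=
        Nat.forall_lt_succ_right
      rw [e]
      simpa [hr 6, hr 16, h16, hr₂ 6, h1] using hf₄
  rintro s₃ ⟨hi, hr, h5, hf⟩
  have hX : ∀ j : Fin n, s.real 6 j = σ.X j := fun j => rfl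
  have hprod : ∀ i : Fin m, s.real 7 i = (I.A *ᵥ σ.X) i := hs.prod
  have hm₃ : s₃.int 0 1 = m := by
    rw [hi 0 (by norm_num) (by norm_num), hi₂ 0 (by norm_num), hin.m_eq]
  have hn₃ : s₃.int 0 0 = n := by rw [hi 0 (by norm_num) (by norm_num), hn₂]
  refine (ensures_loop (t := 98) (fun q s' =>
      (∀ a, a ≠ 3 → a ≠ 13 → s'.int a = s₃.int a) ∧ s'.real = s₃.real ∧
      Flag ((∀ l < n, |s.real 6 l * c| ≤ 1) ∧ ∀ l < q, |s.real 7 l * c| ≤ width n) s') m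
      (by simp [hm₃, h1]) ⟨fun _ _ _ => rfl, rfl, by simpa using hf⟩ ?_).weaken ?_
      (by simp [IExp.cost]; omega)
  · rintro q hq s₄ ⟨hi₄, hr₄, hf₄⟩
    refine Ensures.weaken (ensures_check
      (P := (∀ l < n, |s.real 6 l * c| ≤ 1) ∧ ∀ l < q, |s.real 7 l * c| ≤ width n)
      (by simpa [Flag] using hf₄) _ _) ?_ (by simp [RExp.cost, IExp.cost])
    rintro s₅ ⟨hr₅, hi₅, hf₅⟩
    refine ⟨?_, ?_, ?_⟩
    · intro a ha hb
      rw [hi₅ a ha]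
      simpa [hb] using hi₄ a ha hb
    · rw [hr₅]
      simpa using hr₄
    · have e : ((∀ l < n, |s.real 6 l * c| ≤ 1) ∧ ∀ l < q + 1, |s.real 7 l * c| ≤ width n) ↔
          ((∀ l < n, |s.real 6 l * c| ≤ 1) ∧ ∀ l < q, |s.real 7 l * c| ≤ width n) ∧
            |s.real 7 q * c| ≤ width n := by
        rw [Nat.forall_lt_succ_right, and_assoc]
      rw [e]
      have e₂ : 10 * √n * (Real.log n * (Real.log n * (Real.log n * Real.log n))) = width n := by
        unfold width; ring
      have hn₄ : s₄.int 0 0 = n := by rw [hi₄ 0 (by norm_num) (by norm_num), hn₃]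
      simpa [hr 7, hr 16, h16, hr₂ 7, hr₄, hn₄, e₂] using hf₅
  · rintro s₄ ⟨-, hr₄, ⟨hf, hP, hQ⟩ | ⟨hf, hP⟩⟩
    · refine Or.inl ⟨hf, ?_⟩
      have : toVec n (s₄.real 5) = fun j => σ.X j * c := by
        ext j
        rw [toVec, hr₄, h5 j j.2, hX]
      rw [this]
      refine hI.isGood_smul (fun j => ?_) (fun i => ?_) ?_
      · rw [← hX]; exact hP j j.2
      · rw [← hprod]; exact hQ i i.2
      · rw [hcdef, mul_div_cancel₀ _ ho'.ne]
    · refine Or.inr ⟨hf, ?_⟩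
      rintro (h | ⟨-, hx, hw⟩)
      · linarith
      · refine hP ⟨fun l hl => ?_, fun l hl => ?_⟩
        · exact hx ⟨l, hl⟩
        · have := hw ⟨l, hl⟩
          rwa [← hprod] at this

end phases

section analysis

variable {m n k : ℕ} {I : Input m n} {C : ℝ}

/-! ### Estimates for the parameters -/

theorem four_le_log (hn : 100 ≤ n) : 4 ≤ Real.log n := by
  have h : (100 : ℝ) ≤ n := by exact_mod_cast hn
  rw [Real.le_log_iff_exp_le (by linarith)]
  have h1 := Real.exp_one_lt_d9
  calc Real.exp 4 = Real.exp 1 ^ 4 := by rw [← Real.exp_nat_mul]; norm_num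
    _ ≤ 3 ^ 4 := by gcongr; linarith
    _ ≤ n := by linarith

/-- From m/n ≤ n one gets log(m/n + 2) ≤ 2λ, and √2/3 ≤ 1/2. The assumptions on `m` and `C` make the
penalty MB of the competitor at most ε/6. -/
theorem discBound_le (hn : 100 ≤ n) (hm : m ≤ n ^ 2) (hC : C ≤ √(Real.log n) / 3) :
    discBound C m n ≤ Real.log n * √n / 2 := by
  have hl := four_le_log hn
  have hn' : (100 : ℝ) ≤ n := by exact_mod_cast hn
  have hm' : (m : ℝ) ≤ n ^ 2 := by exact_mod_cast hm
  have h1 : Real.log (m / n + 2) ≤ 2 * Real.log n := by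
    rw [← Real.log_rpow (by linarith)]
    refine Real.log_le_log (by positivity) ?_
    have : (m : ℝ) / n ≤ n := by rw [div_le_iff₀ (by linarith)]; nlinarith
    norm_cast
    push_cast
    nlinarith
  calc discBound C m n ≤ √(Real.log n) / 3 * √(n * (2 * Real.log n)) := by
        unfold discBound
        gcongr
    _ = √(Real.log n) * √(Real.log n) * √n * (√2 / 3) := by
        rw [Real.sqrt_mul (by linarith), Real.sqrt_mul (by norm_num)]
        ring
    _ ≤ Real.log n * √n / 2 := by
        rw [Real.mul_self_sqrt (by linarith)]
        have : √2 ≤ 3 / 2 := by rw [Real.sqrt_le_left (by norm_num)]; norm_num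
        have := mul_nonneg (by linarith : 0 ≤ Real.log n) (Real.sqrt_nonneg n)
        nlinarith

/-- A witness of feasibility, up to a small error. -/
structure Input.Witness (I : Input m n) (C : ℝ) (x : Fin n → ℝ) : Prop where
  abs_le : ∀ j, |x j| ≤ 1
  nonneg : 0 ≤ discBound C m n
  prod_le : ∀ i, |(I.A *ᵥ x) i| ≤ discBound C m n
  obj_le : I.obj ⬝ᵥ x + 19 / 20 * (√n / Real.log n ^ 3) ≤ I.target C

theorem Input.Valid.ρ₀_le_one (hI : I.Valid k) : I.ρ₀ ≤ 1 := by
  have h1 := hI.sum_eq'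
  have h2 : 0 ≤ ∑ i, |I.ρp i| := Finset.sum_nonneg fun _ _ => abs_nonneg _
  have h3 : 0 ≤ ∑ i, |I.ρm i| := Finset.sum_nonneg fun _ _ => abs_nonneg _
  linarith

/-- Giving up ε/20 makes the inequality for the supremum strict, so a point is obtained without
showing that the supremum is attained. Any such point also forces the discrepancy bound to be
nonnegative. -/
theorem Input.Valid.exists_witness (hI : I.Valid k) (hn : 100 ≤ n)
    (hf : Feasible I.A C I.v I.Λ) : ∃ x, I.Witness C x := by
  have hl := four_le_log hn
  have hn' : (100 : ℝ) ≤ n := by exact_mod_cast hn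
  have hs : 0 < √(n : ℝ) := Real.sqrt_pos.2 (by linarith)
  set ε := √(n : ℝ) / Real.log n ^ 3 with hε
  have hε₀ : 0 < ε := by positivity
  have h1 : ((I.Λ * √n - √n * (ε / 20) : ℝ) : EReal) < ((I.Λ * √n : ℝ) : EReal) := by
    rw [EReal.coe_lt_coe_iff]
    nlinarith [mul_pos hs hε₀]
  have h2 := h1.trans_le hf
  simp only [lt_iSup_iff, EReal.coe_lt_coe_iff] at h2
  obtain ⟨x, hx, hv⟩ := h2
  have hB : 0 ≤ discBound C m n := (norm_nonneg _).trans hx.2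
  have hA : ∀ i, |(I.A *ᵥ x) i| ≤ discBound C m n := fun i => (norm_le_pi_norm _ i).trans hx.2
  refine ⟨x, fun j => (norm_le_pi_norm x j).trans hx.1, hB, hA, ?_⟩
  have h3 : ∀ ρ : Fin m → ℝ, |ρ ⬝ᵥ (I.A *ᵥ x)| ≤ (∑ i, |ρ i|) * discBound C m n := by
    intro ρ
    rw [Finset.sum_mul]
    refine (Finset.abs_sum_le_sum_abs _ _).trans (Finset.sum_le_sum fun i _ => ?_)
    rw [abs_mul]
    exact mul_le_mul_of_nonneg_left (hA i) (abs_nonneg _)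
  have h4 := (_root_.abs_le.1 (h3 I.ρp)).2
  have h5 := (_root_.abs_le.1 (h3 I.ρm)).1
  have h6 := hI.ρ₀_le_one
  have h7 : I.Λ - ε / 20 ≤ (I.v ⬝ᵥ x) / √n := by
    rw [le_div_iff₀ hs, dotProduct_comm]
    linarith
  have h8 := mul_le_mul_of_nonneg_left h7 hI.ρ₀_nonneg
  rw [obj_dotProduct, Input.target, ← hI.sum_eq', mul_div_assoc]
  have h9 : I.ρ₀ * ε ≤ ε := mul_le_of_le_one_left hε₀.le h6
  nlinarith

theorem Input.Valid.abs_obj_le (hI : I.Valid k) (hn : 0 < n) (j : Fin n) : |I.obj j| ≤ 2 := by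
  have hs : 0 < √(n : ℝ) := Real.sqrt_pos.2 (by exact_mod_cast hn)
  have hv : |I.v j| ≤ 2 * √n := by
    have := PiLp.norm_apply_le (WithLp.toLp 2 I.v) j
    exact this.trans hI.norm_v
  have h1 : |∑ i, I.A i j * (I.ρp i - I.ρm i)| ≤ 1 - I.ρ₀ := by
    rw [← hI.sum_eq', ← Finset.sum_add_distrib]
    refine (Finset.abs_sum_le_sum_abs _ _).trans (Finset.sum_le_sum fun i _ => ?_)
    rw [abs_mul]
    exact (mul_le_of_le_one_left (abs_nonneg _) (hI.abs_le i j)).trans (abs_sub _ _)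
  have h2 : |I.ρ₀ * I.v j / √n| ≤ 2 * I.ρ₀ := by
    rw [abs_div, abs_mul, abs_of_nonneg hI.ρ₀_nonneg, abs_of_pos hs, div_le_iff₀ hs]
    nlinarith [hI.ρ₀_nonneg]
  have h6 := hI.ρ₀_le_one
  unfold Input.obj
  exact (abs_sub _ _).trans (by linarith)

/-- If the potential is small and no coordinate is large, then the output passes. -/
theorem Input.Valid.passes (hI : I.Valid k) (hn : 100 ≤ n) (hm : m ≤ n ^ 2)
    (hC : C ≤ √(Real.log n) / 3) {x : Fin n → ℝ} (hx : I.Witness C x) {σ : State m n} {S : ℕ}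
    (hS : 0 < S) (hσ : σ.Bounded I.A (rate n) (n * S))
    (hpot : I.obj ⬝ᵥ σ.X + price n / rate n * Real.log σ.total <
      S * (I.obj ⬝ᵥ x + price n * discBound C m n + √n / Real.log n ^ 3 / 5))
    (hX : ∀ j, |σ.X j| ≤ (1 + 1 / (10 * Real.log n ^ 3)) * S) : I.Passes C σ := by
  by_cases hτ : 0 ≤ I.target C
  · exact Or.inl hτ
  rw [not_le] at hτ
  refine Or.inr ?_
  have hl := four_le_log hn
  have hn' : (100 : ℝ) ≤ n := by exact_mod_cast hn
  have hs : 0 < √(n : ℝ) := Real.sqrt_pos.2 (by linarith)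
  have hss : √(n : ℝ) * √n = n := Real.mul_self_sqrt (by linarith)
  have hS' : (0 : ℝ) < S := by exact_mod_cast hS
  set lam := Real.log n with hlam
  set ε := √(n : ℝ) / lam ^ 3 with hε
  have hlam0 : 0 < lam := by linarith
  have hε₀ : 0 < ε := by positivity
  have hM₀ : 0 < price n := by unfold price; rw [← hlam]; positivity
  have hη₀ : 0 < rate n := by unfold rate; positivity
  -- The slack 19ε/20 of the witness pays for four errors: ε/6 for its penalty, ε/6 for the
  -- second-order loss of the weights, ε/5 for random fluctuation and ε/5 for rescaling.
  have hMB : price n * discBound C m n ≤ ε / 6 := by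
    calc price n * discBound C m n ≤ price n * (lam * √n / 2) :=
          mul_le_mul_of_nonneg_left (discBound_le hn hm hC) hM₀.le
      _ = ε / 6 := by rw [price, ← hlam, hε]; field_simp; norm_num
  have hMη : 2 * price n * rate n * n ≤ ε / 6 := by
    have : 2 * price n * rate n * n = ε * (2 / (3 * lam)) := by
      rw [price, rate, ← hlam, hε]
      field_simp
      nlinarith
    rw [this]
    have : 2 / (3 * lam) ≤ 1 / 6 := by
      rw [div_le_div_iff₀ (by positivity) (by norm_num)]; linarith
    nlinarith
  have hτ₂ : -(2 * √n) ≤ I.target C := by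
    have h6 := hI.ρ₀_le_one
    have h1 := mul_nonneg hx.nonneg (sub_nonneg.2 h6)
    have h2 : I.ρ₀ * I.Λ ≤ 2 * √n :=
      (mul_le_of_le_one_left hI.Λ_mem.1 h6).trans hI.Λ_mem.2
    unfold Input.target
    rw [← hlam, ← hε]
    linarith
  -- The overshoot of the coordinates enlarges the scale by the factor 1 + 1/(10λ³); since τ ≥ −2√n,
  -- this costs at most ε/5.
  have hτ₃ : -(ε / 5) ≤ I.target C * (1 / (10 * lam ^ 3)) := by
    calc -(ε / 5) = -(2 * √n) * (1 / (10 * lam ^ 3)) := by rw [hε]; field_simp; norm_num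
      _ ≤ _ := mul_le_mul_of_nonneg_right hτ₂ (by positivity)
  set D := (1 + 1 / (10 * lam ^ 3)) * (S : ℝ) with hD
  have hobj := hx.obj_le
  rw [← hlam, ← hε] at hobj
  -- the normalized point beats the target
  have he : S * (I.obj ⬝ᵥ x + price n * discBound C m n + ε / 5) + 2 * price n * rate n * n * S ≤
      D * I.target C := by
    have : I.obj ⬝ᵥ x + price n * discBound C m n + ε / 5 + 2 * price n * rate n * n ≤
        (1 + 1 / (10 * lam ^ 3)) * I.target C := by linarith
    calc _ = S * (I.obj ⬝ᵥ x + price n * discBound C m n + ε / 5 + 2 * price n * rate n * n) := by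
          ring
      _ ≤ S * ((1 + 1 / (10 * lam ^ 3)) * I.target C) := mul_le_mul_of_nonneg_left this hS'.le
      _ = _ := by rw [hD]; ring
  have hlog : 0 ≤ Real.log σ.total := Real.log_nonneg (State.one_le_total fun i => hσ.pos i)
  have hpl : 0 ≤ price n / rate n * Real.log σ.total := by positivity
  have hpS : 0 ≤ 2 * price n * rate n * n * S := by positivity
  have hD₀ : 0 < D := by positivity
  have hw : I.obj ⬝ᵥ σ.X ≤ D * I.target C := by linarith
  have hw₀ : I.obj ⬝ᵥ σ.X < 0 := hw.trans_lt (mul_neg_of_pos_of_neg hD₀ hτ)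
  refine ⟨hw₀, fun j => ?_, fun i => ?_⟩
  · rw [abs_mul, abs_div, abs_of_neg hw₀, abs_of_neg hτ, ← mul_div_assoc,
      div_le_one (by linarith)]
    have := mul_le_mul_of_nonneg_right (hX j) (by linarith : 0 ≤ -I.target C)
    linarith
  · have h1 := hσ.abs_le_log hη₀ i
    have h2 := mul_le_mul_of_nonneg_left h1 hM₀.le
    have h3 : price n * (Real.log σ.total / rate n + 2 * rate n * (n * S : ℕ)) =
        price n / rate n * Real.log σ.total + 2 * price n * rate n * n * S := by
      push_cast; ring
    rw [h3] at h2
    -- The potential bound makes objective plus penalty at most Dτ, which is negative.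
    have h4 : price n * |(I.A *ᵥ σ.X) i| ≤ -(I.obj ⬝ᵥ σ.X) := by
      have := mul_neg_of_pos_of_neg hD₀ hτ
      linarith
    rw [abs_mul, abs_div, abs_of_neg hw₀, abs_of_neg hτ, ← mul_div_assoc,
      div_le_iff₀ (by linarith)]
    have h5 : 2 * √n ≤ price n * width n := by
      rw [price, width, ← hlam]
      field_simp
      norm_num
    have h6 : |(I.A *ᵥ σ.X) i| * -I.target C ≤ |(I.A *ᵥ σ.X) i| * (price n * width n) :=
      mul_le_mul_of_nonneg_left (by linarith) (abs_nonneg _)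
    have hw0 : 0 ≤ width n := by unfold width; positivity
    calc _ ≤ _ := h6
      _ = width n * (price n * |(I.A *ᵥ σ.X) i|) := by ring
      _ ≤ _ := mul_le_mul_of_nonneg_left h4 hw0

end analysis

/-! ### Tail bounds, failure probability and running time -/

section final

variable {m n k : ℕ} {I : Input m n} {C : ℝ} {L : Columns I.A} {s : Mem} {W : ℕ}

/-- The parameter of the exponential moment of the objective. -/
noncomputable def momentRate (n : ℕ) : ℝ := 1 / (90 * √n * Real.log n ^ 3)

/-- The parameter of the exponential moment of the coordinates. -/
noncomputable def coordRate (n : ℕ) : ℝ := 1 / (20 * Real.log n ^ 3)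

/-- At least `1` when the potential is large after `S` rounds. -/
noncomputable def objExcess (I : Input m n) (C : ℝ) (x : Fin n → ℝ) (S : ℕ) (σ : State m n) : ℝ :=
  State.pot I.obj (rate n) (price n) (momentRate n) σ * Real.exp (-(momentRate n *
    (S * (I.obj ⬝ᵥ x + price n * discBound C m n + √n / Real.log n ^ 3 / 5))))

/-- At least `1` when coordinate `l` is large after `S` rounds. -/
noncomputable def coordExcess (S : ℕ) (l : Fin n) (σ : State m n) : ℝ :=
  Real.exp (coordRate n * |σ.X l|) *
    Real.exp (-(coordRate n * ((1 + 1 / (10 * Real.log n ^ 3)) * S)))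

theorem exp_log_bound (hn : 100 ≤ n) {t : ℝ} (ht : t ≤ -(Real.log n / 2) - 1) :
    Real.exp t ≤ 1 / √n / 2 := by
  have hn' : (0 : ℝ) < n := by exact_mod_cast (by omega)
  have h1 : Real.exp (-(Real.log n / 2)) = 1 / √n := by
    rw [Real.exp_neg, ← Real.log_sqrt hn'.le, Real.exp_log (Real.sqrt_pos.2 hn'), one_div]
  have h2 := Real.add_one_le_exp 1
  have h3 : Real.exp (-1) ≤ 1 / 2 := by
    rw [Real.exp_neg, one_div]
    exact inv_anti₀ (by norm_num) (by linarith)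
  calc Real.exp t ≤ Real.exp (-(Real.log n / 2) + -1) := Real.exp_le_exp.2 (by linarith)
    _ = 1 / √n * Real.exp (-1) := by rw [Real.exp_add, h1]
    _ ≤ 1 / √n * (1 / 2) := mul_le_mul_of_nonneg_left h3 (by positivity)
    _ = _ := by ring

/-- In the exponent the drift cancels against the threshold. The allowance θSε/5 = S/(450λ⁶) is
twice the variance term 9nSθ², leaving −S/(900λ⁶) ≤ −(10/9)λ; the initial potential adds at most
1/10. -/
theorem mean_objExcess_le (hW : BigWords W n m) (hn : 100 ≤ n) (hm : m ≤ n ^ 2) (hI : I.Valid k)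
    {x : Fin n → ℝ} (hx : I.Witness C x) (hs : Prepared I C L s)
    (hS : 1000 * Real.log n ^ 7 ≤ (1000 * s.int 4 0 ^ 7 : ℕ)) :
    mean (Prog.mainLoop.run W s) (fun o => ENNReal.ofReal
      (objExcess I C x (1000 * s.int 4 0 ^ 7) (read m n o.1))) ≤ ENNReal.ofReal (1 / √n / 2) := by
  have hl := four_le_log hn
  have hn' : (100 : ℝ) ≤ n := by exact_mod_cast hn
  have hsq : (10 : ℝ) ≤ √n := Real.le_sqrt_of_sq_le (by linarith)
  have hss : √(n : ℝ) ^ 2 = n := Real.sq_sqrt (by linarith)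
  set S := 1000 * s.int 4 0 ^ 7 with hSdef
  set lam := Real.log n with hlam
  set θ := momentRate n with hθ
  have hlam0 : 0 < lam := by linarith
  have hθ₀ : 0 < θ := by rw [hθ, momentRate]; positivity
  have hlam3 : 1 ≤ lam ^ 3 := one_le_pow₀ (by linarith)
  have hlam4 : 1 ≤ lam ^ 4 := one_le_pow₀ (by linarith)
  have hθ₁ : 3 * θ ≤ 1 := by
    have h1 : (1 : ℝ) ≤ √n * lam ^ 3 := one_le_mul_of_one_le_of_one_le (by linarith) hlam3
    rw [hθ, momentRate, ← hlam, mul_one_div, div_le_one (by positivity)]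
    linarith
  have hM₀ : 0 ≤ price n := by rw [price]; positivity
  have hM₁ : price n ≤ 1 := by
    rw [price, ← hlam, div_le_one (by positivity)]
    linarith
  have hη₀ := rate_pos (n := n) (by omega)
  set c := I.obj ⬝ᵥ x + price n * discBound C m n with hc
  refine (mean_mainLoop_le hW (by omega) hI.abs_le hs (F := objExcess I C x S)
    (fun σ => by unfold objExcess State.pot; positivity)
    (c := θ * c / n + 9 * θ ^ 2) ?_).trans ?_
  · intro σ t hσ
    have h1 := State.avg_pot_step_le (by omega : 0 < n) (fun i => hσ.pos i) hI.abs_le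
      (hI.abs_obj_le (by omega)) hη₀ (rate_le (by omega)) hθ₀.le hθ₁ hM₀ hM₁ hx.abs_le hx.nonneg
      hx.prod_le
    simp only [objExcess, ← Finset.sum_mul]
    rw [mul_div_right_comm]
    exact (mul_le_mul_of_nonneg_right h1 (Real.exp_pos _).le).trans_eq (mul_assoc _ _ _)
  · refine ENNReal.ofReal_le_ofReal ?_
    unfold objExcess State.pot
    rw [← Real.exp_add, ← Real.exp_add]
    apply exp_log_bound hn
    have htot : (State.init m n).total = 1 + m + m := by simp [State.total, State.init]
    have hX : I.obj ⬝ᵥ (State.init m n).X = 0 := by simp [State.init, dotProduct]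
    have hlog : Real.log (1 + m + m) ≤ 3 * lam := by
      have hm' : (m : ℝ) ≤ n ^ 2 := by exact_mod_cast hm
      rw [hlam, show (3 : ℝ) = (3 : ℕ) by norm_num, ← Real.log_pow]
      refine Real.log_le_log (by positivity) ?_
      nlinarith
    rw [htot, hX, ← hθ, ← hc, zero_add, ← hSdef, Nat.cast_mul]
    have e1 : (n : ℝ) * S * (θ * c / n + 9 * θ ^ 2) = S * (θ * c) + 9 * n * S * θ ^ 2 := by
      field_simp
    have e2 : 9 * n * S * θ ^ 2 - θ * (S * (√n / lam ^ 3 / 5)) = -(S / (900 * lam ^ 6)) := by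
      rw [hθ, momentRate, ← hlam]
      field_simp
      rw [hss]
      ring
    have e3 : θ * (price n / rate n * Real.log (1 + m + m)) ≤ 1 / 10 := by
      have h0 : 0 ≤ Real.log (1 + m + m) := Real.log_nonneg (by
        have : (0 : ℝ) ≤ m := Nat.cast_nonneg m
        linarith)
      calc _ = Real.log (1 + m + m) / (270 * lam ^ 7) := by
            rw [hθ, momentRate, price, rate, ← hlam]
            field_simp
            ring
        _ ≤ 3 * lam / (270 * lam ^ 7) := by gcongr
        _ = 1 / (90 * lam ^ 6) := by field_simp; norm_num
        _ ≤ 1 / 10 := by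
            have : 1 ≤ lam ^ 6 := one_le_pow₀ (by linarith)
            exact one_div_le_one_div_of_le (by norm_num) (by linarith)
    have e4 : 10 / 9 * lam ≤ S / (900 * lam ^ 6) := by
      rw [le_div_iff₀ (by positivity)]
      calc _ = 1000 * lam ^ 7 := by ring
        _ ≤ _ := hS
    have e5 : θ * (S * (c + √n / lam ^ 3 / 5)) = S * (θ * c) + θ * (S * (√n / lam ^ 3 / 5)) := by
      ring
    rw [e1, e5]
    linarith

/-- The overshoot 1/(10λ³) equals 2δ, so the exponent is S(δ + δ²) − δ(1 + 2δ)S = −δ²S ≤ −(5/2)λ.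
This absorbs log n for the union bound over coordinates and still leaves 1/(2√n). -/
theorem mean_coordExcess_le (hW : BigWords W n m) (hn : 100 ≤ n) (hI : I.Valid k)
    (hs : Prepared I C L s) (hS : 1000 * Real.log n ^ 7 ≤ (1000 * s.int 4 0 ^ 7 : ℕ)) (l : Fin n) :
    mean (Prog.mainLoop.run W s) (fun o => ENNReal.ofReal
      (coordExcess (1000 * s.int 4 0 ^ 7) l (read m n o.1))) ≤
      ENNReal.ofReal (1 / √n / 2 / n) := by
  have hl := four_le_log hn
  have hn' : (100 : ℝ) ≤ n := by exact_mod_cast hn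
  set S := 1000 * s.int 4 0 ^ 7 with hSdef
  set lam := Real.log n with hlam
  set δ := coordRate n with hδ
  have hlam0 : 0 < lam := by linarith
  have hδ₀ : 0 < δ := by rw [hδ, coordRate]; positivity
  have hlam3 : 1 ≤ lam ^ 3 := one_le_pow₀ (by linarith)
  have hδ₁ : δ ≤ 1 := by
    rw [hδ, coordRate, ← hlam, div_le_one (by positivity)]
    linarith
  refine (mean_mainLoop_le hW (by omega) hI.abs_le hs (F := coordExcess S l)
    (fun σ => by unfold coordExcess; positivity) (c := (δ + δ ^ 2) / n) ?_).trans ?_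
  · intro σ t _
    have h1 := State.avg_exp_abs_step_le (A := I.A) (w := I.obj) (η := rate n) (M := price n)
      (σ := σ) (by omega : 0 < n) hδ₀.le hδ₁ l
    simp only [coordExcess, ← Finset.sum_mul]
    rw [mul_div_right_comm]
    exact (mul_le_mul_of_nonneg_right h1 (Real.exp_pos _).le).trans_eq (mul_assoc _ _ _)
  · refine ENNReal.ofReal_le_ofReal ?_
    unfold coordExcess
    rw [le_div_iff₀ (by linarith)]
    have e0 : ∀ t, Real.exp t * n = Real.exp (t + Real.log n) := fun t => by
      rw [Real.exp_add, Real.exp_log (by linarith)]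
    rw [← Real.exp_add, ← Real.exp_add, e0]
    apply exp_log_bound hn
    rw [← hδ, ← hlam]
    simp only [State.init, abs_zero, mul_zero, zero_add]
    rw [← hSdef, Nat.cast_mul]
    have e1 : (n : ℝ) * S * ((δ + δ ^ 2) / n) = S * (δ + δ ^ 2) := by field_simp
    have e2 : S * (δ + δ ^ 2) - δ * ((1 + 1 / (10 * lam ^ 3)) * S) = -(S / (400 * lam ^ 6)) := by
      rw [hδ, coordRate, ← hlam]
      field_simp
      ring
    have e4 : 5 / 2 * lam ≤ S / (400 * lam ^ 6) := by
      rw [le_div_iff₀ (by positivity)]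
      calc _ = 1000 * lam ^ 7 := by ring
        _ ≤ _ := hS
    rw [e1]
    linarith

/-- A state that does not pass has a large potential or a large coordinate. -/
theorem one_le_excess (hn : 100 ≤ n) (hm : m ≤ n ^ 2) (hI : I.Valid k)
    (hC : C ≤ √(Real.log n) / 3) {x : Fin n → ℝ} (hx : I.Witness C x) {σ : State m n} {S : ℕ}
    (hS : 0 < S) (hσ : σ.Bounded I.A (rate n) (n * S)) (hp : ¬ I.Passes C σ) :
    1 ≤ ENNReal.ofReal (objExcess I C x S σ) + ∑ l, ENNReal.ofReal (coordExcess S l σ) := by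
  have hl := four_le_log hn
  have hn' : (100 : ℝ) ≤ n := by exact_mod_cast hn
  have hθ₀ : 0 < momentRate n := by
    have : 0 < √(n : ℝ) := Real.sqrt_pos.2 (by linarith)
    unfold momentRate; positivity
  have hδ₀ : 0 < coordRate n := by unfold coordRate; positivity
  by_contra hlt
  rw [not_le] at hlt
  refine hp (hI.passes hn hm hC hx hS hσ ?_ fun l => ?_)
  · have h1 := (le_self_add (a := ENNReal.ofReal (objExcess I C x S σ))).trans_lt hlt
    rw [ENNReal.ofReal_lt_one, objExcess, State.pot, ← Real.exp_add, Real.exp_lt_one_iff] at h1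
    have h2 : momentRate n * (I.obj ⬝ᵥ σ.X + price n / rate n * Real.log σ.total) <
      momentRate n *
        (S * (I.obj ⬝ᵥ x + price n * discBound C m n + √n / Real.log n ^ 3 / 5)) := by linarith
    exact lt_of_mul_lt_mul_left h2 hθ₀.le
  · have h1 := (Finset.single_le_sum (f := fun l => ENNReal.ofReal (coordExcess S l σ))
      (fun _ _ => zero_le) (Finset.mem_univ l)).trans_lt (le_add_self.trans_lt hlt)
    rw [ENNReal.ofReal_lt_one, coordExcess, ← Real.exp_add, Real.exp_lt_one_iff] at h1
    have h2 : coordRate n * |σ.X l| ≤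
      coordRate n * ((1 + 1 / (10 * Real.log n ^ 3)) * S) := by linarith
    exact le_of_mul_le_mul_left h2 hδ₀

theorem Prepared.log_le (hn : 100 ≤ n) (hs : Prepared I C L s) : Real.log n ≤ s.int 4 0 := by
  have hn' : (0 : ℝ) < n := by exact_mod_cast (by omega)
  have h1 : (n : ℝ) ≤ 2 ^ s.int 4 0 := by exact_mod_cast hs.le_pow
  have h2 := Real.log_le_log hn' h1
  rw [Real.log_pow] at h2
  have := Real.log_two_lt_d9
  have : (0 : ℝ) ≤ s.int 4 0 := Nat.cast_nonneg _
  nlinarith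

theorem Prepared.le_log (hn : 100 ≤ n) (hs : Prepared I C L s) :
    (s.int 4 0 : ℝ) ≤ 2 * Real.log n := by
  have hn' : (0 : ℝ) < n := by exact_mod_cast (by omega)
  have h1 : (2 : ℝ) ^ s.int 4 0 ≤ 2 * n := by exact_mod_cast hs.pow_le
  have h2 := Real.log_le_log (by positivity) h1
  rw [Real.log_pow, Real.log_mul (by norm_num) hn'.ne'] at h2
  have := Real.log_two_gt_d9
  have := Real.log_two_lt_d9
  have := four_le_log hn
  have : (0 : ℝ) ≤ s.int 4 0 := Nat.cast_nonneg _
  nlinarith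

/-- The final memory after a run from a prepared memory is correct up to a small probability. -/
theorem mean_incorrect_le (hW : BigWords W n m) (hn : 100 ≤ n) (hm : m ≤ n ^ 2) (hI : I.Valid k)
    (hC : C ≤ √(Real.log n) / 3) (hs : Prepared I C L s) {f : Mem → ℝ≥0∞} (hf₁ : ∀ s, f s ≤ 1)
    (hf : ∀ s, I.Correct C s → f s = 0) :
    mean ((Cmd.seq Prog.mainLoop Prog.finish).run W s) (fun o => f o.1) ≤
      ENNReal.ofReal (1 / √n) := by
  obtain ⟨K, hK⟩ : ∃ K, ∀ j : Fin n, L.len j ≤ K :=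
    ⟨∑ j : Fin n, L.len j, fun j =>
      Finset.single_le_sum (f := fun j : Fin n => L.len j) (fun _ _ => Nat.zero_le _)
        (Finset.mem_univ j)⟩
  have hn' : (0 : ℝ) < n := by exact_mod_cast (by omega)
  have hl := four_le_log hn
  have hll := hs.log_le hn
  rw [mean_seq]
  have hloop := ensures_mainLoop hW (by omega) hI.abs_le hK hs
  -- For a feasible program a wrong answer needs a state that does not pass; for an infeasible one
  -- every possible output is correct.
  by_cases hF : Feasible I.A C I.v I.Λ
  · obtain ⟨x, hx⟩ := hI.exists_witness hn hF
    set S := 1000 * s.int 4 0 ^ 7 with hSdef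
    have hS : 1000 * Real.log n ^ 7 ≤ (S : ℝ) := by
      rw [hSdef]; push_cast; gcongr
    have hS₀ : 0 < S := by
      have : (0 : ℝ) < S := lt_of_lt_of_le (by positivity) hS
      exact_mod_cast this
    calc _ ≤ mean (Prog.mainLoop.run W s) (fun o =>
          ENNReal.ofReal (objExcess I C x S (read m n o.1)) +
          ∑ l, ENNReal.ofReal (coordExcess S l (read m n o.1))) := by
          refine mean_mono fun o ho => ?_
          obtain ⟨hc, hb⟩ := (hloop o ho).1
          by_cases hp : I.Passes C (read m n o.1)
          · refine (mean_le (c := 0) fun o' ho' => ?_).trans (zero_le)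
            rcases (ensures_finish hW hI hc o' ho').1 with h | h
            · exact (hf _ (Or.inr h)).le
            · exact absurd hp h.2
          · exact (mean_le fun o' _ => hf₁ _).trans (one_le_excess hn hm hI hC hx hS₀ hb hp)
      _ ≤ ENNReal.ofReal (1 / √n / 2) + ∑ l : Fin n, ENNReal.ofReal (1 / √n / 2 / n) := by
          rw [mean_add, mean_sum]
          exact add_le_add (mean_objExcess_le hW hn hm hI hx hs hS)
            (Finset.sum_le_sum fun l _ => mean_coordExcess_le hW hn hI hs hS l)
      _ = ENNReal.ofReal (1 / √n) := by
          rw [← ENNReal.ofReal_sum_of_nonneg fun _ _ => by positivity,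
            ← ENNReal.ofReal_add (by positivity) (by positivity)]
          congr 1
          simp only [Finset.sum_const, Finset.card_univ, Fintype.card_fin, nsmul_eq_mul]
          field_simp
          norm_num
  · refine (mean_le (c := 0) fun o ho => mean_le fun o' ho' => ?_).trans (zero_le)
    rcases (ensures_finish hW hI (hloop o ho).1.1 o' ho').1 with h | h
    · exact (hf _ (Or.inr h)).le
    · exact (hf _ (Or.inl ⟨h.1, hF⟩)).le

theorem bigWords_words (hn : 100 ≤ n) (hm : m ≤ n ^ 2) : BigWords (words 12 n) n m := by
  have h1 : n ^ 12 ≤ words 12 n := by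
    have := Nat.pow_le_pow_left (Nat.le_pow_clog (by norm_num : 1 < 2) n) 12
    rwa [← pow_mul, mul_comm] at this
  have h2 : 100 ^ 4 * n ^ 8 ≤ n ^ 12 := by
    calc 100 ^ 4 * n ^ 8 ≤ n ^ 4 * n ^ 8 := by gcongr
      _ = n ^ 12 := by ring
  have h3 : n ^ 3 ≤ n ^ 8 := Nat.pow_le_pow_right (by omega) (by norm_num)
  have h4 : n ≤ n ^ 8 := Nat.le_self_pow (by norm_num) n
  have h5 : n ^ 2 ≤ n ^ 8 := Nat.pow_le_pow_right (by omega) (by norm_num)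
  have h6 : n * m ≤ n ^ 3 := by
    calc n * m ≤ n * n ^ 2 := Nat.mul_le_mul_left n hm
      _ = n ^ 3 := by ring
  refine ⟨by omega, by omega, fun l hl => ?_⟩
  calc n * (1000 * l ^ 7) ≤ n * (1000 * (2 * n) ^ 7) := by gcongr
    _ = 128000 * n ^ 8 := by ring
    _ < words 12 n := by omega

theorem Input.Valid.len_le (hI : I.Valid k) (L : Columns I.A) (j : Fin n) : L.len j ≤ k := by
  rw [L.len_eq]
  exact hI.sparse j

theorem ensures_oracle (hW : BigWords W n m) (hn : 100 ≤ n) (hm : m ≤ n ^ 2) (hI : I.Valid k) :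
    ∀ o ∈ (Prog.oracle.run W (I.mem C L)).support,
      (o.2 : ℝ) ≤ 20000000 * (k * n + n ^ 2) * Real.log n ^ 7 := by
  intro o ho
  have hl := four_le_log hn
  have hn' : (100 : ℝ) ≤ n := by exact_mod_cast hn
  have hm' : (m : ℝ) ≤ n ^ 2 := by exact_mod_cast hm
  have hk' : (0 : ℝ) ≤ k := Nat.cast_nonneg k
  simp only [Prog.oracle, Cmd.run, PMF.mem_support_bind_iff, PMF.mem_support_pure_iff] at ho
  obtain ⟨o₁, ho₁, o₂, ⟨o₃, ho₃, o₄, ho₄, rfl⟩, rfl⟩ := ho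
  obtain ⟨h₁, t₁⟩ := ensures_prepare hW (by omega) o₁ ho₁
  obtain ⟨h₃, t₃⟩ := ensures_mainLoop hW (by omega) hI.abs_le (hI.len_le L) h₁ o₃ ho₃
  obtain ⟨-, t₄⟩ := ensures_finish hW hI h₃.1 o₄ ho₄
  have hl7 := pow_le_pow_left₀ (Nat.cast_nonneg _) (h₁.le_log hn) 7
  have ht₁ : (o₁.2 : ℝ) ≤ n * 30 + 30 := by exact_mod_cast t₁
  have ht₃ : (o₃.2 : ℝ) ≤
      n * (1000 * (o₁.1.int 4 0 : ℝ) ^ 7) * (n * 20 + k * 150 + 304) + 50 := by exact_mod_cast t₃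
  have ht₄ : (o₄.2 : ℝ) ≤ n * 100 + m * 100 + 400 := by exact_mod_cast t₄
  have hlam7 : 1 ≤ Real.log n ^ 7 := one_le_pow₀ (by linarith)
  set Q := (k : ℝ) * n + n ^ 2 with hQ
  have hnQ : (n : ℝ) ^ 2 ≤ Q := by rw [hQ]; nlinarith
  have hn2 : 100 * (n : ℝ) ≤ n ^ 2 := by nlinarith
  have h5 : (n : ℝ) * (n * 20 + k * 150 + 304) ≤ 150 * Q := by rw [hQ]; nlinarith
  have h6 : n * (1000 * (o₁.1.int 4 0 : ℝ) ^ 7) * (n * 20 + k * 150 + 304) ≤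
      1000 * (2 * Real.log n) ^ 7 * (150 * Q) := by
    calc _ = 1000 * (o₁.1.int 4 0 : ℝ) ^ 7 * (n * (n * 20 + k * 150 + 304)) := by ring
      _ ≤ _ := by gcongr
  have h7 : Q ≤ Q * Real.log n ^ 7 := le_mul_of_one_le_right (by positivity) hlam7
  push_cast
  -- The main loop contributes 19200000 = 1000 · 2⁷ · 150, where 2⁷ comes from ℓ ≤ 2λ. The other
  -- phases are linear in n and m and fit into 300Q because m ≤ n² ≤ Q.
  calc (o₁.2 : ℝ) + (o₃.2 + o₄.2) ≤ 19200000 * (Q * Real.log n ^ 7) + 300 * Q := by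
        have : 1000 * (2 * Real.log n) ^ 7 * (150 * Q) = 19200000 * (Q * Real.log n ^ 7) := by ring
        linarith
    _ ≤ _ := by linarith

end final

end Oracle

theorem proposition4p1 :
    ∃ (P : RealRAM.Cmd) (w : ℕ) (K : ℝ) (b : ℕ),
      ∀ (n m k : ℕ) (C : ℝ), 100 ≤ n → m ≤ n ^ 2 → C ≤ √(Real.log n) / 3 →
      ∀ (I : Oracle.Input m n) (L : RealRAM.Columns I.A), I.Valid k →
        (∀ o ∈ (P.run (RealRAM.words w n) (I.mem C L)).support,
          (o.2 : ℝ) ≤ K * (k * n + n ^ 2) * Real.log n ^ b) ∧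
        ENNReal.ofReal (1 - 1 / √n) ≤
          (P.run (RealRAM.words w n) (I.mem C L)).toOuterMeasure {o | I.Correct C o.1} := by
  classical
  -- Twelve logarithms per word give at least n¹² words, enough for the iteration count, which is at
  -- most 128000n⁸ even with the crude bound ℓ ≤ 2n.
  refine ⟨Oracle.Prog.oracle, 12, 20000000, 7, fun n m k C hn hm hC I L hI => ?_⟩
  have hW := Oracle.bigWords_words hn hm
  refine ⟨Oracle.ensures_oracle hW hn hm hI, ?_⟩
  rw [ENNReal.ofReal_sub _ (by positivity), ENNReal.ofReal_one]
  refine RealRAM.toOuterMeasure_ge (fun o => if I.Correct C o.1 then 0 else 1)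
    (fun o _ ho => by rw [if_neg (by simpa using ho)]) ?_
  rw [Oracle.Prog.oracle, RealRAM.mean_seq _ _ fun s => if I.Correct C s then 0 else 1]
  refine RealRAM.mean_le fun o ho => ?_
  exact Oracle.mean_incorrect_le hW hn hm hI hC (Oracle.ensures_prepare hW (by omega) o ho).1
    (f := fun s => if I.Correct C s then 0 else 1) (fun s => by split_ifs <;> simp)
    (fun s hs => by simp [hs])
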